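/- Fix $0<p<1$ and put $[x]=\frac12\sum_{n\in\mathbb Z}(-1)^{n-\frac12}p^{(n+\frac12)^2}e^{-(2n+1)x}$ for $x\in\mathbb C$, where $(-1)^{n-1/2}=e^{i\pi(n-1/2)}$. Let $L\ge 1$ be an integer and let $\gamma,\mu_1,\dots,\mu_L\in\mathbb C$. Let $W=\mathbb C^2$ with basis $v_1,v_2$, let $h\in\mathrm{End}(W)$ be given by $hv_1=v_1$, $hv_2=-v_2$, and let $R(x;\tau)\in\mathrm{End}(W\otimes W)$ be given in the ordered basis $v_1\otimes v_1,v_1\otimes v_2,v_2\otimes v_1,v_2\otimes v_2$ by $$R(x;\tau)=\begin{pmatrix}[x+\gamma]&0&0&0\\0&\frac{[\tau-\gamma][x]}{[\tau]}&\frac{[\tau-x][\gamma]}{[\tau]}&0\\0&\frac{[\tau+x][\gamma]}{[\tau]}&\frac{[\tau+\gamma][x]}{[\tau]}&0\\0&0&0&[x+\gamma]\end{pmatrix}.$$ With $W_0=W_1=\dots=W_L=W$, the dynamical monodromy matrix on $W_0\otimes W_1\otimes\cdots\otimes W_L$ is the product, ordered from left to right for $i=1,\dots,L$, of the operators $R_{0i}\bigl(x-\mu_i;\tau-\gamma\sum_{k=i+1}^{L}h_k\bigr)$,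 where $R_{0i}$ acts on $W_0\otimes W_i$ and $h_k$ denotes $h$ acting on $W_k$ (on a vector on which $\sum_{k>i}h_k$ acts as the scalar $m$, the operator acts as $R_{0i}(x-\mu_i;\tau-\gamma m)$). Writing it as $\begin{pmatrix}\mathcal A(x,\tau)&\mathcal B(x,\tau)\\\mathcal C(x,\tau)&\mathcal D(x,\tau)\end{pmatrix}$ with respect to $W_0$, define the domain-wall partition function $$Z_\tau(x_1,\dots,x_L)=\langle\bar 0|\,\mathcal B(x_1,\tau+\gamma)\,\mathcal B(x_2,\tau+2\gamma)\cdots\mathcal B(x_L,\tau+L\gamma)\,|0\rangle,\qquad |0\rangle=\begin{pmatrix}1\\0\end{pmatrix}^{\otimes L},\quad \langle\bar 0|=\begin{pmatrix}0&1\end{pmatrix}^{\otimes L}.$$ In $Z_\tau$ only the dynamical denominators $[\tau+k\gamma]$ with $1\le k\le L$ occur. Let $X=(x_1,\dots,x_L)\in\mathbb C^L$ and $x_{\bar 0},\tau\in\mathbb C$ be such that $[\tau+k\gamma]\ne0$ for $1\le k\le L+1$, $[x_{\bar 0}-x_i]\neq0$ for all $i$, and $[x_i-x_j]\ne0$ for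 all $i\ne j$. Let $X_{\bar 0}^{\bar 0}=X$ and, for $1\le i\le L$, let $X_i^{\bar 0}$ be obtained from $X$ by replacing $x_i$ with $x_{\bar 0}$. Then $$M_0\,Z_{\tau+\gamma}(X)+\sum_{i\in\{\bar 0,1,\dots,L\}}N_i\,Z_\tau(X_i^{\bar 0})=0,$$ where $$M_0=\prod_{j=1}^L[x_{\bar 0}-\mu_j+\gamma],\qquad N_{\bar 0}=-\prod_{j=1}^L[x_{\bar 0}-\mu_j]\prod_{j=1}^L\frac{[x_{\bar 0}-x_j+\gamma]}{[x_{\bar 0}-x_j]},$$ $$N_i=\frac{[\gamma]\,[\tau+(L+1)\gamma+x_{\bar 0}-x_i]}{[x_{\bar 0}-x_i]\,[\tau+(L+1)\gamma]}\prod_{j=1}^L[x_i-\mu_j]\prod_{\substack{j=1\\j\ne i}}^L\frac{[x_i-x_j+\gamma]}{[x_i-x_j]}\qquad(1\le i\le L).$$ -/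

import Mathlib

/-! The elliptic solid-on-solid model with domain-wall boundaries.

`p` is the elliptic nome, `γ` the anisotropy parameter, `μ i` the inhomogeneities, `τ` the dynamical
parameter. The space `W = ℂ²` has the ordered basis `v₁, v₂`, indexed here by `0, 1 : Fin 2`; the
tensor power `W^{⊗L}` has the product basis, indexed by `Fin L → Fin 2`, and operators are written
as matrices in these bases (`M r c` is the coefficient of the basis vector `r` in the image of the
basis vector `c`). -/

noncomputable section

namespace EllipticSOS

/-- The theta function `[x] = ½ ∑_{n ∈ ℤ} (-1)^{n-1/2} p^{(n+1/2)²} e^{-(2n+1)x}`, with the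
principal branch `(-1)^{n-1/2} = e^{iπ(n-1/2)}`. -/
def theta (p : ℝ) (x : ℂ) : ℂ :=
  1 / 2 * ∑' n : ℤ, (-1 : ℂ) ^ ((n : ℂ) - 1 / 2) *
    ((p ^ (((n : ℝ) + 1 / 2) ^ 2) : ℝ) : ℂ) * Complex.exp (-(2 * (n : ℂ) + 1) * x)

/-- The dynamical R-matrix `R(x; τ)` on `W ⊗ W`, in the ordered basis
`v₁⊗v₁, v₁⊗v₂, v₂⊗v₁, v₂⊗v₂`. -/
def rMatrix (p : ℝ) (γ x τ : ℂ) : Matrix (Fin 2 × Fin 2) (Fin 2 × Fin 2) ℂ :=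
  (!![theta p (x + γ), 0, 0, 0;
      0, theta p (τ - γ) * theta p x / theta p τ, theta p (τ - x) * theta p γ / theta p τ, 0;
      0, theta p (τ + x) * theta p γ / theta p τ, theta p (τ + γ) * theta p x / theta p τ, 0;
      0, 0, 0, theta p (x + γ)]).submatrix finProdFinEquiv finProdFinEquiv

/-- The weights of the Cartan generator `h` on `W`: `1` on `v₁` and `-1` on `v₂`. -/
def weight : Fin 2 → ℂ := ![1, -1]

/-- The factor `R_{0i}(x - μᵢ; τ - γ ∑_{k > i} h_k)` acting on `W₀ ⊗ W^{⊗L}`. -/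
def rFactor (p : ℝ) (γ : ℂ) {L : ℕ} (μ : Fin L → ℂ) (x τ : ℂ) (i : Fin L) :
    Matrix (Fin 2 × (Fin L → Fin 2)) (Fin 2 × (Fin L → Fin 2)) ℂ :=
  Matrix.of fun r c =>
    if ∀ k, k ≠ i → r.2 k = c.2 k then
      rMatrix p γ (x - μ i) (τ - γ * ∑ k ∈ Finset.Ioi i, weight (c.2 k))
        (r.1, r.2 i) (c.1, c.2 i)
    else 0

/-- The dynamical monodromy matrix: the ordered product, from left to right for `i = 1, …, L`, of
the factors `R_{0i}(x - μᵢ; τ - γ ∑_{k > i} h_k)`. -/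
def monodromy (p : ℝ) (γ : ℂ) {L : ℕ} (μ : Fin L → ℂ) (x τ : ℂ) :
    Matrix (Fin 2 × (Fin L → Fin 2)) (Fin 2 × (Fin L → Fin 2)) ℂ :=
  (List.ofFn fun i : Fin L => rFactor p γ μ x τ i).prod

/-- The operator `B(x, τ)` on `W^{⊗L}`: the upper right block of the monodromy matrix with respect
to the auxiliary space `W₀`. -/
def opB (p : ℝ) (γ : ℂ) {L : ℕ} (μ : Fin L → ℂ) (x τ : ℂ) :
    Matrix (Fin L → Fin 2) (Fin L → Fin 2) ℂ :=
  Matrix.of fun s t => monodromy p γ μ x τ (0, s) (1, t)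

/-- The vector `|0⟩ = (1, 0)^{⊗L}`. -/
def ketZero (L : ℕ) : (Fin L → Fin 2) → ℂ :=
  fun s => ∏ i, (![1, 0] : Fin 2 → ℂ) (s i)

/-- The covector `⟨0̄| = (0, 1)^{⊗L}`. -/
def braZeroBar (L : ℕ) : (Fin L → Fin 2) → ℂ :=
  fun s => ∏ i, (![0, 1] : Fin 2 → ℂ) (s i)

/-- The domain-wall partition function
`Z_τ(x₁, …, x_L) = ⟨0̄| B(x₁, τ + γ) B(x₂, τ + 2γ) ⋯ B(x_L, τ + Lγ) |0⟩`
(the index `j : Fin L` stands for `j + 1`). -/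
def partitionFunction (p : ℝ) (γ : ℂ) {L : ℕ} (μ : Fin L → ℂ) (τ : ℂ) (x : Fin L → ℂ) : ℂ :=
  dotProduct (braZeroBar L)
    (Matrix.mulVec
      (List.ofFn fun j : Fin L => opB p γ μ (x j) (τ + ((j : ℕ) + 1 : ℂ) * γ)).prod
      (ketZero L))

/-- The coefficient `M₀` of the functional equation of type D; `x₀` stands for `x_{0̄}`. -/
def coeffM (p : ℝ) (γ : ℂ) {L : ℕ} (μ : Fin L → ℂ) (x₀ : ℂ) : ℂ :=
  ∏ j, theta p (x₀ - μ j + γ)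

/-- The coefficient `N_{0̄}` of the functional equation of type D. -/
def coeffNZero (p : ℝ) (γ : ℂ) {L : ℕ} (μ x : Fin L → ℂ) (x₀ : ℂ) : ℂ :=
  -((∏ j, theta p (x₀ - μ j)) * ∏ j, theta p (x₀ - x j + γ) / theta p (x₀ - x j))

/-- The coefficients `N_i`, `1 ≤ i ≤ L`, of the functional equation of type D. -/
def coeffN (p : ℝ) (γ τ : ℂ) {L : ℕ} (μ x : Fin L → ℂ) (x₀ : ℂ) (i : Fin L) : ℂ :=
  theta p γ * theta p (τ + ((L : ℂ) + 1) * γ + x₀ - x i) /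
      (theta p (x₀ - x i) * theta p (τ + ((L : ℂ) + 1) * γ)) *
    (∏ j, theta p (x i - μ j)) *
    ∏ j ∈ Finset.univ.erase i, theta p (x i - x j + γ) / theta p (x i - x j)

end EllipticSOS

end

/-! The identity comes from computing `⟨0̄| D(x₀, τ+γ) B(x₁, τ+2γ) ⋯ B(x_L, τ+(L+1)γ) |0⟩` in two
ways. Acting to the left, `D` conserves the number of down spins and the all-down state is alone in
its sector, so `⟨0̄|` is an eigencovector with eigenvalue `M₀` (`opD_mulVec_one`). This gives `M₀
Z_{τ+γ}(X)`.

Acting to the right, `D` is commuted through all the `B`'s as in the algebraic Bethe ansatz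
(`opD_mulVec_betheVector`). Each exchange lowers the dynamical parameter of the `B` it passes by
`γ`, so the result involves `Z_τ`: one term where `D` keeps `x₀`, giving `N_{0̄}`, and for each `i`
one where `x₀` replaces `x_i`, giving `N_i`. The symmetry of the vector in its spectral parameters
collects equal terms, and the coefficients combine by `theta_exchange`.

The commutation rules are entries of the relation `R₁₂ T₁ T₂ = T₂ T₁ R₁₂` (`monodromy_exchange`),
proved by induction on the number of sites from the dynamical Yang–Baxter equation (`yangBaxter`).
That in turn rests on Weierstrass' three-term identity `theta_weierstrass`.

This argument divides by `[τ+kγ]` for integers `k` outside the allowed range, so it is run for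
`Generic` `τ`. Such `τ` are dense, and both `Z_τ` and the coefficients are continuous wherever the
stated denominators do not vanish. -/

noncomputable section

namespace EllipticSOS

open Matrix

/-! ### Theta series: holomorphy, oddness, Weierstrass' identity. -/

/-- The Gaussian `p^{k²/2} e^{-2kx}`. -/
def gauss (p : ℝ) (x : ℂ) (k : ℤ) : ℂ :=
  Complex.exp (Real.log p * (k : ℂ) ^ 2 / 2 - 2 * k * x)

/-- The `n`-th term of the theta series `2[x]`, written as an exponential. -/
def thetaTerm (p : ℝ) (x : ℂ) (n : ℤ) : ℂ :=
  Complex.exp (Real.pi * Complex.I * ((n : ℂ) - 1 / 2) + Real.log p * ((n : ℂ) + 1 / 2) ^ 2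
    - (2 * n + 1) * x)

theorem theta_eq_tsum {p : ℝ} (hp : 0 < p) (x : ℂ) :
    theta p x = 1 / 2 * ∑' n : ℤ, thetaTerm p x n := by
  unfold theta
  congr 1
  refine tsum_congr fun n => ?_
  have h1 : (-1 : ℂ) ^ ((n : ℂ) - 1 / 2)
      = Complex.exp (Real.pi * Complex.I * ((n : ℂ) - 1 / 2)) := by
    rw [Complex.cpow_def_of_ne_zero (by norm_num), Complex.log_neg_one]
  have h2 : ((p ^ (((n : ℝ) + 1 / 2) ^ 2) : ℝ) : ℂ)
      = Complex.exp (Real.log p * ((n : ℂ) + 1 / 2) ^ 2) := by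
    rw [Real.rpow_def_of_pos hp]
    push_cast
    rfl
  rw [h1, h2, ← Complex.exp_add, ← Complex.exp_add, thetaTerm]
  congr 1
  ring

/-- The modular parameter attached to a nome `p`. -/
def nomeTau (p : ℝ) : ℂ := -(Complex.I * Real.log p / Real.pi)

theorem nomeTau_im_pos {p : ℝ} (hp0 : 0 < p) (hp1 : p < 1) : 0 < (nomeTau p).im := by
  have h : nomeTau p = ((-(Real.log p / Real.pi) : ℝ) : ℂ) * Complex.I := by
    unfold nomeTau; push_cast; ring
  rw [h, Complex.im_ofReal_mul]
  simp only [Complex.I_im, mul_one]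
  exact neg_pos.2 (div_neg_of_neg_of_pos (Real.log_neg hp0 hp1) Real.pi_pos)

theorem pi_I_nomeTau (p : ℝ) : Real.pi * Complex.I * nomeTau p = Real.log p := by
  have : (Real.pi : ℂ) ≠ 0 := by exact_mod_cast Real.pi_ne_zero
  unfold nomeTau
  field_simp
  simp

/-- With `e^{iπτ} = p`, the shift by `1/2` in the Jacobi variable produces the alternating sign and
the shift by `τ/2` the half-integer exponents. Convergence and holomorphy then follow from those of
`jacobiTheta₂`. -/
theorem thetaTerm_eq (p : ℝ) (x : ℂ) (n : ℤ) :
    thetaTerm p x n =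
      Complex.exp (-(Real.pi * Complex.I / 2) + Real.log p / 4 - x) *
        jacobiTheta₂_term n (1 / 2 + nomeTau p / 2 + x * Complex.I / Real.pi) (nomeTau p) := by
  have hpi : (Real.pi : ℂ) ≠ 0 := by exact_mod_cast Real.pi_ne_zero
  rw [thetaTerm, jacobiTheta₂_term, ← Complex.exp_add]
  congr 1
  have h1 : 2 * (Real.pi : ℂ) * Complex.I * n *
      (1 / 2 + nomeTau p / 2 + x * Complex.I / Real.pi) =
      Real.pi * Complex.I * n + n * (Real.pi * Complex.I * nomeTau p) - 2 * n * x := by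
    field_simp
    ring_nf
    simp only [Complex.I_sq]
    ring
  have h2 : (Real.pi : ℂ) * Complex.I * n ^ 2 * nomeTau p
    = n ^ 2 * (Real.pi * Complex.I * nomeTau p) := by ring
  rw [h1, h2, pi_I_nomeTau]
  ring

theorem summable_thetaTerm {p : ℝ} (hp0 : 0 < p) (hp1 : p < 1) (x : ℂ) :
    Summable (thetaTerm p x) := by
  have h := ((summable_jacobiTheta₂_term_iff
    (1 / 2 + nomeTau p / 2 + x * Complex.I / Real.pi) _).2 (nomeTau_im_pos hp0 hp1)).mul_left
      (Complex.exp (-(Real.pi * Complex.I / 2) + Real.log p / 4 - x))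
  exact h.congr fun n => (thetaTerm_eq p x n).symm

theorem differentiable_theta {p : ℝ} (hp0 : 0 < p) (hp1 : p < 1) :
    Differentiable ℂ (theta p) := by
  have h : theta p = fun x => 1 / 2 *
      (Complex.exp (-(Real.pi * Complex.I / 2) + Real.log p / 4 - x) *
        jacobiTheta₂ (1 / 2 + nomeTau p / 2 + x * Complex.I / Real.pi) (nomeTau p)) := by
    funext x
    rw [theta_eq_tsum hp0, jacobiTheta₂]
    simp only [thetaTerm_eq, tsum_mul_left]
  rw [h]
  intro x
  refine DifferentiableAt.const_mul (DifferentiableAt.mul (by fun_prop) ?_) _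
  exact (differentiableAt_jacobiTheta₂_fst _ (nomeTau_im_pos hp0 hp1)).comp x
    (f := fun x : ℂ => 1 / 2 + nomeTau p / 2 + x * Complex.I / Real.pi) (by fun_prop)

/-- The reflection `n ↦ -1 - n` preserves `(n + 1/2)²`, negates `2n + 1`, and changes the phase by
an odd multiple of `iπ`. -/
theorem theta_neg {p : ℝ} (hp : 0 < p) (x : ℂ) : theta p (-x) = -theta p x := by
  rw [theta_eq_tsum hp, theta_eq_tsum hp, ← mul_neg, ← tsum_neg]
  congr 1
  rw [← (Equiv.subLeft (-1 : ℤ)).tsum_eq]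
  refine tsum_congr fun n => ?_
  rw [← neg_one_mul (thetaTerm _ _ _), ← Complex.exp_pi_mul_I]
  simp only [thetaTerm, Equiv.subLeft_apply]
  rw [← Complex.exp_add, Complex.exp_eq_exp_iff_exists_int]
  refine ⟨-n - 1, ?_⟩
  push_cast
  ring

/-- The change of summation indices `u = m + n + 1`, `v = m - n`, split by the parity of `u`. -/
def parityMap : (ℤ × ℤ) ⊕ (ℤ × ℤ) → ℤ × ℤ :=
  Sum.elim (fun q => (q.1 + q.2, q.1 - q.2 - 1)) (fun q => (q.1 + q.2, q.1 - q.2))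

theorem bijective_parityMap : Function.Bijective parityMap := by
  constructor
  · rintro (⟨a, b⟩ | ⟨a, b⟩) (⟨c, d⟩ | ⟨c, d⟩) h <;>
      simp only [parityMap, Sum.elim_inl, Sum.elim_inr, Prod.mk.injEq, Sum.inl.injEq,
        Sum.inr.injEq, reduceCtorEq] at h ⊢ <;> omega
  · rintro ⟨m, n⟩
    rcases Int.even_or_odd (m + n) with ⟨k, hk⟩ | ⟨k, hk⟩
    · refine ⟨Sum.inr (k, m - k), ?_⟩
      simp only [parityMap, Sum.elim_inr, Prod.mk.injEq]; omega
    · refine ⟨Sum.inl (k + 1, m - k - 1), ?_⟩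
      simp only [parityMap, Sum.elim_inl, Prod.mk.injEq]; omega

theorem thetaTerm_mul_even (p : ℝ) (x y : ℂ) (a b : ℤ) :
    thetaTerm p (x + y) (a + b) * thetaTerm p (x - y) (a - b - 1) =
      gauss p x (2 * a) * gauss p y (2 * b + 1) := by
  simp only [thetaTerm, gauss, ← Complex.exp_add]
  rw [Complex.exp_eq_exp_iff_exists_int]
  refine ⟨a - 1, ?_⟩
  push_cast
  ring

theorem thetaTerm_mul_odd (p : ℝ) (x y : ℂ) (a b : ℤ) :
    thetaTerm p (x + y) (a + b) * thetaTerm p (x - y) (a - b) =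
      -(gauss p x (2 * a + 1) * gauss p y (2 * b)) := by
  rw [← neg_one_mul, ← Complex.exp_pi_mul_I]
  simp only [thetaTerm, gauss, ← Complex.exp_add]
  rw [Complex.exp_eq_exp_iff_exists_int]
  refine ⟨a - 1, ?_⟩
  push_cast
  ring

theorem summable_gauss {p : ℝ} (hp0 : 0 < p) (hp1 : p < 1) (x : ℂ) : Summable (gauss p x) := by
  have hpi : (Real.pi : ℂ) ≠ 0 := by exact_mod_cast Real.pi_ne_zero
  have him : 0 < (nomeTau p / 2).im := by
    have := nomeTau_im_pos hp0 hp1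
    rw [show nomeTau p / 2 = nomeTau p / (2 : ℝ) by push_cast; rfl, Complex.div_ofReal_im]
    positivity
  refine ((summable_jacobiTheta₂_term_iff (x * Complex.I / Real.pi) _).2 him).congr fun k => ?_
  rw [gauss, jacobiTheta₂_term, ← pi_I_nomeTau]
  congr 1
  field_simp
  ring_nf
  simp only [Complex.I_sq]
  ring

/-- The even part `∑ p^{2a²} e^{-4ax}`. -/
def gaussEven (p : ℝ) (x : ℂ) : ℂ := ∑' a : ℤ, gauss p x (2 * a)

/-- The odd part `∑ p^{(2a+1)²/2} e^{-2(2a+1)x}`. -/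
def gaussOdd (p : ℝ) (x : ℂ) : ℂ := ∑' a : ℤ, gauss p x (2 * a + 1)

/-- The exponents obey `(m+1/2)² + (n+1/2)² = (u² + v²)/2` with `u = m+n+1`, `v = m-n` of opposite
parity, and the sign is `(-1)^u`. The product is thus a 2×2 determinant in the vectors `(gaussEven,
gaussOdd)` at `x` and `y`, which makes Weierstrass' identity the Plücker relation for four vectors
in a plane. -/
theorem theta_add_mul_theta_sub {p : ℝ} (hp0 : 0 < p) (hp1 : p < 1) (x y : ℂ) :
    theta p (x + y) * theta p (x - y) =
      1 / 4 * (gaussEven p x * gaussOdd p y - gaussOdd p x * gaussEven p y) := by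
  have hE : ∀ z, Summable fun a : ℤ => ‖gauss p z (2 * a)‖ := fun z =>
    (summable_gauss hp0 hp1 z).norm.comp_injective (i := fun a : ℤ => 2 * a)
      fun a b h => by simpa using h
  have hO : ∀ z, Summable fun a : ℤ => ‖gauss p z (2 * a + 1)‖ := fun z =>
    (summable_gauss hp0 hp1 z).norm.comp_injective (i := fun a : ℤ => 2 * a + 1)
      fun a b h => by simpa using h
  have hT := fun z => (summable_thetaTerm hp0 hp1 z).norm
  have hS := summable_mul_of_summable_norm (hT (x + y)) (hT (x - y))
  have hEO := summable_mul_of_summable_norm (hE x) (hO y)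
  have hOE := summable_mul_of_summable_norm (hO x) (hE y)
  have key : (∑' n, thetaTerm p (x + y) n) * ∑' n, thetaTerm p (x - y) n =
      gaussEven p x * gaussOdd p y - gaussOdd p x * gaussEven p y := by
    rw [tsum_mul_tsum_of_summable_norm (hT _) (hT _), gaussEven, gaussEven, gaussOdd, gaussOdd,
      tsum_mul_tsum_of_summable_norm (hE _) (hO _), tsum_mul_tsum_of_summable_norm (hO _) (hE _),
      ← (Equiv.ofBijective _ bijective_parityMap).tsum_eq, Summable.tsum_sum]
    · rw [sub_eq_add_neg (tsum _), ← tsum_neg]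
      congr 1
      · exact tsum_congr fun q => thetaTerm_mul_even p x y q.1 q.2
      · exact tsum_congr fun q => thetaTerm_mul_odd p x y q.1 q.2
    · exact hEO.congr fun q => (thetaTerm_mul_even p x y q.1 q.2).symm
    · exact hOE.neg.congr fun q => (thetaTerm_mul_odd p x y q.1 q.2).symm
  rw [theta_eq_tsum hp0, theta_eq_tsum hp0, ← key]
  ring

/-- Weierstrass' three-term identity, with the arguments `a ± b`, `c ± d`, … given up to a proof. -/
theorem theta_weierstrass {p : ℝ} (hp0 : 0 < p) (hp1 : p < 1) (a b c d : ℂ)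
    {u₁ u₂ u₃ u₄ v₁ v₂ v₃ v₄ w₁ w₂ w₃ w₄ : ℂ}
    (hu₁ : u₁ = a + b := by ring) (hu₂ : u₂ = a - b := by ring)
    (hu₃ : u₃ = c + d := by ring) (hu₄ : u₄ = c - d := by ring)
    (hv₁ : v₁ = a + c := by ring) (hv₂ : v₂ = a - c := by ring)
    (hv₃ : v₃ = b + d := by ring) (hv₄ : v₄ = b - d := by ring)
    (hw₁ : w₁ = a + d := by ring) (hw₂ : w₂ = a - d := by ring)
    (hw₃ : w₃ = b + c := by ring) (hw₄ : w₄ = b - c := by ring) :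
    theta p u₁ * theta p u₂ * (theta p u₃ * theta p u₄) -
      theta p v₁ * theta p v₂ * (theta p v₃ * theta p v₄) +
      theta p w₁ * theta p w₂ * (theta p w₃ * theta p w₄) = 0 := by
  subst_vars
  simp only [theta_add_mul_theta_sub hp0 hp1]
  ring

/-! ### The dynamical Yang–Baxter equation, entry by entry. -/

theorem rMatrix_entries (p : ℝ) (γ x τ : ℂ) :
    rMatrix p γ x τ (0, 0) (0, 0) = theta p (x + γ) ∧
    rMatrix p γ x τ (0, 1) (0, 1) = theta p (τ - γ) * theta p x / theta p τ ∧
    rMatrix p γ x τ (0, 1) (1, 0) = theta p (τ - x) * theta p γ / theta p τ ∧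
    rMatrix p γ x τ (1, 0) (0, 1) = theta p (τ + x) * theta p γ / theta p τ ∧
    rMatrix p γ x τ (1, 0) (1, 0) = theta p (τ + γ) * theta p x / theta p τ ∧
    rMatrix p γ x τ (1, 1) (1, 1) = theta p (x + γ) :=
  ⟨rfl, rfl, rfl, rfl, rfl, rfl⟩

theorem rMatrix_zeros (p : ℝ) (γ x τ : ℂ) :
    rMatrix p γ x τ (0, 0) (0, 1) = 0 ∧ rMatrix p γ x τ (0, 0) (1, 0) = 0 ∧
    rMatrix p γ x τ (0, 0) (1, 1) = 0 ∧ rMatrix p γ x τ (0, 1) (0, 0) = 0 ∧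
    rMatrix p γ x τ (0, 1) (1, 1) = 0 ∧ rMatrix p γ x τ (1, 0) (0, 0) = 0 ∧
    rMatrix p γ x τ (1, 0) (1, 1) = 0 ∧ rMatrix p γ x τ (1, 1) (0, 0) = 0 ∧
    rMatrix p γ x τ (1, 1) (0, 1) = 0 ∧ rMatrix p γ x τ (1, 1) (1, 0) = 0 :=
  ⟨rfl, rfl, rfl, rfl, rfl, rfl, rfl, rfl, rfl, rfl⟩

theorem sub_weight_zero (γ τ : ℂ) : τ - γ * weight 0 = τ - γ := by simp [weight]

theorem sub_weight_one (γ τ : ℂ) : τ - γ * weight 1 = τ + γ := by simp [weight]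

/-- Matrix entries of `R₁₂(x - y; τ - γh₃) R₁₃(x; τ) R₂₃(y; τ - γh₁)`. -/
def yangBaxterLeft (p : ℝ) (γ x y τ : ℂ) (a₁ a₂ a₃ b₁ b₂ b₃ : Fin 2) : ℂ :=
  ∑ c₁, ∑ c₂, ∑ k, rMatrix p γ (x - y) (τ - γ * weight a₃) (a₁, a₂) (c₁, c₂) *
    rMatrix p γ x τ (c₁, a₃) (b₁, k) * rMatrix p γ y (τ - γ * weight b₁) (c₂, k) (b₂, b₃)

/-- Matrix entries of `R₂₃(y; τ) R₁₃(x; τ - γh₂) R₁₂(x - y; τ)`. -/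
def yangBaxterRight (p : ℝ) (γ x y τ : ℂ) (a₁ a₂ a₃ b₁ b₂ b₃ : Fin 2) : ℂ :=
  ∑ c₁, ∑ c₂, ∑ k, rMatrix p γ y τ (a₂, a₃) (c₂, k) *
    rMatrix p γ x (τ - γ * weight c₂) (a₁, k) (c₁, b₃) *
      rMatrix p γ (x - y) τ (c₁, c₂) (b₁, b₂)

theorem yangBaxter_001_001 {p : ℝ} {γ τ : ℂ} (x y : ℂ)
    (hτ : theta p τ ≠ 0) (hm : theta p (τ - γ) ≠ 0) :
    yangBaxterLeft p γ x y τ 0 0 1 0 0 1 =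
    yangBaxterRight p γ x y τ 0 0 1 0 0 1 := by
  simp only [yangBaxterLeft, yangBaxterRight, Fin.sum_univ_two, rMatrix_entries,
    rMatrix_zeros, zero_mul, mul_zero, add_zero, zero_add, sub_weight_zero, sub_weight_one]
  field_simp

/-- Each off-diagonal entry of the one-down-spin sector is a multiple of a single Weierstrass
identity. The half-integral combinations come from solving `a ± b = u₁, u₂` and `c ± d = u₃, u₄`. -/
theorem yangBaxter_001_010 {p : ℝ} (hp0 : 0 < p) (hp1 : p < 1) {γ τ : ℂ} (x y : ℂ)
    (hτ : theta p τ ≠ 0) (hm : theta p (τ - γ) ≠ 0) :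
    yangBaxterLeft p γ x y τ 0 0 1 0 1 0 =
    yangBaxterRight p γ x y τ 0 0 1 0 1 0 := by
  have h0 := theta_weierstrass hp0 hp1 (1 / 2 * x + 1 / 2 * τ) (-1 / 2 * x + 1 / 2 * τ)
    (1 / 2 * x - 1 / 2 * τ + γ) (1 / 2 * x - y + 1 / 2 * τ)
    (u₁ := τ) (u₂ := x) (u₃ := x - y + γ) (u₄ := -(τ - γ - y))
    (v₁ := x + γ) (v₂ := τ - γ) (v₃ := τ - y) (v₄ := -(x - y))
    (w₁ := τ + (x - y)) (w₂ := y) (w₃ := γ) (w₄ := τ - γ - x)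
  simp only [theta_neg hp0] at h0
  simp only [yangBaxterLeft, yangBaxterRight, Fin.sum_univ_two, rMatrix_entries,
    rMatrix_zeros, zero_mul, mul_zero, add_zero, zero_add, sub_weight_zero, sub_weight_one]
  linear_combination (norm := (field_simp; ring)) - theta p γ / (theta p τ ^ 2) * h0

theorem yangBaxter_001_100 {p : ℝ} (hp0 : 0 < p) (hp1 : p < 1) {γ τ : ℂ} (x y : ℂ)
    (hτ : theta p τ ≠ 0) (hm : theta p (τ - γ) ≠ 0) :
    yangBaxterLeft p γ x y τ 0 0 1 1 0 0 =
    yangBaxterRight p γ x y τ 0 0 1 1 0 0 := by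
  have h0 := theta_weierstrass hp0 hp1 (1 / 2 * y + 1 / 2 * τ + 1 / 2 * γ)
    (-1 / 2 * y + 1 / 2 * τ - 1 / 2 * γ)
    (x - 1 / 2 * y - 1 / 2 * τ + 1 / 2 * γ) (1 / 2 * y - 1 / 2 * τ - 1 / 2 * γ)
    (u₁ := τ) (u₂ := y + γ) (u₃ := -(τ - x)) (u₄ := x - y + γ)
    (v₁ := x + γ) (v₂ := τ - (x - y)) (v₃ := -γ) (v₄ := τ - y)
    (w₁ := y) (w₂ := τ + γ) (w₃ := x - y) (w₄ := τ - γ - x)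
  simp only [theta_neg hp0] at h0
  simp only [yangBaxterLeft, yangBaxterRight, Fin.sum_univ_two, rMatrix_entries,
    rMatrix_zeros, zero_mul, mul_zero, add_zero, zero_add, sub_weight_zero, sub_weight_one]
  linear_combination (norm := (field_simp; ring)) - theta p γ / (theta p τ ^ 2) * h0

theorem yangBaxter_010_001 {p : ℝ} (hp0 : 0 < p) (hp1 : p < 1) {γ τ : ℂ} (x y : ℂ)
    (hτ : theta p τ ≠ 0) (hm : theta p (τ - γ) ≠ 0) :
    yangBaxterLeft p γ x y τ 0 1 0 0 0 1 =
    yangBaxterRight p γ x y τ 0 1 0 0 0 1 := by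
  have h0 := theta_weierstrass hp0 hp1 (1 / 2 * y + τ - 1 / 2 * γ) (-1 / 2 * y - 1 / 2 * γ)
    (1 / 2 * y - 1 / 2 * γ) (x - 1 / 2 * y + 1 / 2 * γ)
    (u₁ := τ - γ) (u₂ := τ + y) (u₃ := x) (u₄ := -(x - y + γ))
    (v₁ := τ - γ + y) (v₂ := τ) (v₃ := x - y) (v₄ := -(x + γ))
    (w₁ := τ + x) (w₂ := τ - γ - (x - y)) (w₃ := -γ) (w₄ := -y)
  simp only [theta_neg hp0] at h0
  simp only [yangBaxterLeft, yangBaxterRight, Fin.sum_univ_two, rMatrix_entries,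
    rMatrix_zeros, zero_mul, mul_zero, add_zero, zero_add, sub_weight_zero, sub_weight_one]
  linear_combination (norm := (field_simp; ring))
    theta p γ * theta p (τ - γ - γ) / (theta p (τ - γ) ^ 2 * theta p τ) * h0

/-- The only entry that needs two Weierstrass identities. Both contain `[2τ - γ]`, which is foreign
to the R-matrix; the coefficients are chosen so that it cancels. -/
theorem yangBaxter_010_010 {p : ℝ} (hp0 : 0 < p) (hp1 : p < 1) {γ τ : ℂ} (x y : ℂ)
    (hτ : theta p τ ≠ 0) (hm : theta p (τ - γ) ≠ 0) :
    yangBaxterLeft p γ x y τ 0 1 0 0 1 0 =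
    yangBaxterRight p γ x y τ 0 1 0 0 1 0 := by
  have e0 : theta p (τ - γ + γ) = theta p τ := by congr 1; ring
  have h0 := theta_weierstrass hp0 hp1 (τ) (0)
    (γ) (τ - γ)
    (u₁ := τ) (u₂ := τ) (u₃ := τ) (u₄ := -(τ - γ - γ))
    (v₁ := τ + γ) (v₂ := τ - γ) (v₃ := τ - γ) (v₄ := -(τ - γ))
    (w₁ := 2 * τ - γ) (w₂ := γ) (w₃ := γ) (w₄ := -γ)
  simp only [theta_neg hp0] at h0
  have h1 := theta_weierstrass hp0 hp1 (1 / 2 * x - 1 / 2 * y + 1 / 2 * γ)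
    (-1 / 2 * x + 1 / 2 * y + τ - 1 / 2 * γ)
    (1 / 2 * x - 1 / 2 * y + τ - 1 / 2 * γ) (1 / 2 * x + 1 / 2 * y + 1 / 2 * γ)
    (u₁ := τ) (u₂ := -(τ - γ - (x - y))) (u₃ := τ + x) (u₄ := τ - γ - y)
    (v₁ := τ + (x - y)) (v₂ := -(τ - γ)) (v₃ := τ + y) (v₄ := τ - γ - x)
    (w₁ := x + γ) (w₂ := -y) (w₃ := 2 * τ - γ) (w₄ := -(x - y))
  simp only [theta_neg hp0] at h1
  simp only [yangBaxterLeft, yangBaxterRight, Fin.sum_univ_two, rMatrix_entries,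
    rMatrix_zeros, zero_mul, mul_zero, add_zero, zero_add, sub_weight_zero, sub_weight_one, e0]
  linear_combination (norm := (field_simp; ring))
    - theta p (x - y) * theta p y * theta p (x + γ) /
        (theta p (τ - γ) ^ 2 * theta p τ ^ 2) * h0 -
      theta p γ ^ 3 / (theta p τ ^ 2 * theta p (τ - γ) ^ 2) * h1

theorem yangBaxter_010_100 {p : ℝ} (hp0 : 0 < p) (hp1 : p < 1) {γ τ : ℂ} (x y : ℂ)
    (hτ : theta p τ ≠ 0) (hm : theta p (τ - γ) ≠ 0) :
    yangBaxterLeft p γ x y τ 0 1 0 1 0 0 =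
    yangBaxterRight p γ x y τ 0 1 0 1 0 0 := by
  have h0 := theta_weierstrass hp0 hp1 (1 / 2 * x - 1 / 2 * τ) (-1 / 2 * x + y + 1 / 2 * τ)
    (1 / 2 * x + 1 / 2 * τ) (1 / 2 * x - 1 / 2 * τ + γ)
    (u₁ := y) (u₂ := -(τ - (x - y))) (u₃ := x + γ) (u₄ := τ - γ)
    (v₁ := x) (v₂ := -(τ)) (v₃ := y + γ) (v₄ := τ - γ - (x - y))
    (w₁ := -(τ - γ - x)) (w₂ := -γ) (w₃ := τ + y) (w₄ := -(x - y))
  simp only [theta_neg hp0] at h0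
  simp only [yangBaxterLeft, yangBaxterRight, Fin.sum_univ_two, rMatrix_entries,
    rMatrix_zeros, zero_mul, mul_zero, add_zero, zero_add, sub_weight_zero, sub_weight_one]
  linear_combination (norm := (field_simp; ring))
    theta p γ * theta p (τ + γ) / (theta p τ ^ 2 * theta p (τ - γ)) * h0

theorem yangBaxter_100_001 {p : ℝ} (hp0 : 0 < p) (hp1 : p < 1) {γ τ : ℂ} (x y : ℂ)
    (hτ : theta p τ ≠ 0) (hm : theta p (τ - γ) ≠ 0) :
    yangBaxterLeft p γ x y τ 1 0 0 0 0 1 =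
    yangBaxterRight p γ x y τ 1 0 0 0 0 1 := by
  have e0 : theta p (τ - γ + γ) = theta p τ := by congr 1; ring
  have h0 := theta_weierstrass hp0 hp1 (1 / 2 * x + 1 / 2 * y + 1 / 2 * τ)
    (-1 / 2 * x + 1 / 2 * y - 1 / 2 * τ + γ)
    (-1 / 2 * x + 1 / 2 * y + 1 / 2 * τ - γ) (1 / 2 * x - 1 / 2 * y + 1 / 2 * τ)
    (u₁ := y + γ) (u₂ := τ - γ + x) (u₃ := τ - γ) (u₄ := -(x - y + γ))
    (v₁ := τ - γ + y) (v₂ := x + γ) (v₃ := γ) (v₄ := -(τ - γ + (x - y)))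
    (w₁ := τ + x) (w₂ := y) (w₃ := -(x - y)) (w₄ := -(τ - γ - γ))
  simp only [theta_neg hp0] at h0
  simp only [yangBaxterLeft, yangBaxterRight, Fin.sum_univ_two, rMatrix_entries,
    rMatrix_zeros, zero_mul, mul_zero, add_zero, zero_add, sub_weight_zero, sub_weight_one, e0]
  linear_combination (norm := (field_simp; ring)) theta p γ / (theta p (τ - γ) ^ 2) * h0

theorem yangBaxter_100_010 {p : ℝ} (hp0 : 0 < p) (hp1 : p < 1) {γ τ : ℂ} (x y : ℂ)
    (hτ : theta p τ ≠ 0) (hm : theta p (τ - γ) ≠ 0) :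
    yangBaxterLeft p γ x y τ 1 0 0 0 1 0 =
    yangBaxterRight p γ x y τ 1 0 0 0 1 0 := by
  have e0 : theta p (τ - γ + γ) = theta p τ := by congr 1; ring
  have h0 := theta_weierstrass hp0 hp1 (1 / 2 * y + 1 / 2 * τ) (-1 / 2 * y + 1 / 2 * τ)
    (-1 / 2 * y + 1 / 2 * τ - γ) (x - 1 / 2 * y + 1 / 2 * τ)
    (u₁ := τ) (u₂ := y) (u₃ := τ - γ + (x - y)) (u₄ := -(x + γ))
    (v₁ := τ - γ) (v₂ := y + γ) (v₃ := τ + (x - y)) (v₄ := -x)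
    (w₁ := τ + x) (w₂ := -(x - y)) (w₃ := τ - γ - y) (w₄ := γ)
  simp only [theta_neg hp0] at h0
  simp only [yangBaxterLeft, yangBaxterRight, Fin.sum_univ_two, rMatrix_entries,
    rMatrix_zeros, zero_mul, mul_zero, add_zero, zero_add, sub_weight_zero, sub_weight_one, e0]
  linear_combination (norm := (field_simp; ring)) - theta p γ / (theta p (τ - γ) ^ 2) * h0

theorem yangBaxter_100_100 {p : ℝ} {γ τ : ℂ} (x y : ℂ)
    (hτ : theta p τ ≠ 0) (hm : theta p (τ - γ) ≠ 0) (hq : theta p (τ + γ) ≠ 0) :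
    yangBaxterLeft p γ x y τ 1 0 0 1 0 0 =
    yangBaxterRight p γ x y τ 1 0 0 1 0 0 := by
  have e0 : theta p (τ - γ + γ) = theta p τ := by congr 1; ring
  simp only [yangBaxterLeft, yangBaxterRight, Fin.sum_univ_two, rMatrix_entries,
    rMatrix_zeros, zero_mul, mul_zero, add_zero, zero_add, sub_weight_zero, sub_weight_one, e0]
  field_simp

theorem weight_rev (a : Fin 2) : weight a.rev = -weight a := by
  fin_cases a <;> simp [weight, Fin.rev]

/-- As theta is odd, `τ ↦ -τ` amounts to flipping all spins. The sectors with two or three down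
spins therefore reduce to those with at most one. -/
theorem rMatrix_neg {p : ℝ} (hp0 : 0 < p) (γ x τ : ℂ) (a b c d : Fin 2) :
    rMatrix p γ x (-τ) (a, b) (c, d) = rMatrix p γ x τ (a.rev, b.rev) (c.rev, d.rev) := by
  have h1 : theta p (-τ - γ) = -theta p (τ + γ) := by rw [← theta_neg hp0]; congr 1; ring
  have h2 : theta p (-τ + γ) = -theta p (τ - γ) := by rw [← theta_neg hp0]; congr 1; ring
  have h3 : theta p (-τ - x) = -theta p (τ + x) := by rw [← theta_neg hp0]; congr 1; ring
  have h4 : theta p (-τ + x) = -theta p (τ - x) := by rw [← theta_neg hp0]; congr 1; ring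
  have r0 : (0 : Fin 2).rev = 1 := rfl
  have r1 : (1 : Fin 2).rev = 0 := rfl
  revert a b c d
  simp only [Fin.forall_fin_two, r0, r1, rMatrix_entries, rMatrix_zeros, h1, h2, h3, h4,
    theta_neg hp0, neg_mul, neg_div_neg_eq, and_self]

theorem yangBaxterLeft_neg {p : ℝ} (hp0 : 0 < p) (γ x y τ : ℂ) (a₁ a₂ a₃ b₁ b₂ b₃ : Fin 2) :
    yangBaxterLeft p γ x y (-τ) a₁ a₂ a₃ b₁ b₂ b₃ =
      yangBaxterLeft p γ x y τ a₁.rev a₂.rev a₃.rev b₁.rev b₂.rev b₃.rev := by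
  have h (a : Fin 2) : -τ - γ * weight a = -(τ - γ * weight a.rev) := by rw [weight_rev]; ring
  simp only [yangBaxterLeft, h, rMatrix_neg hp0]
  refine Fintype.sum_equiv Fin.revPerm _ _ fun c₁ => Fintype.sum_equiv Fin.revPerm _ _ fun c₂ =>
    Fintype.sum_equiv Fin.revPerm _ _ fun k => ?_
  simp only [Fin.revPerm_apply]

theorem yangBaxterRight_neg {p : ℝ} (hp0 : 0 < p) (γ x y τ : ℂ) (a₁ a₂ a₃ b₁ b₂ b₃ : Fin 2) :
    yangBaxterRight p γ x y (-τ) a₁ a₂ a₃ b₁ b₂ b₃ =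
      yangBaxterRight p γ x y τ a₁.rev a₂.rev a₃.rev b₁.rev b₂.rev b₃.rev := by
  have h (a : Fin 2) : -τ - γ * weight a = -(τ - γ * weight a.rev) := by rw [weight_rev]; ring
  simp only [yangBaxterRight, h, rMatrix_neg hp0]
  refine Fintype.sum_equiv Fin.revPerm _ _ fun c₁ => Fintype.sum_equiv Fin.revPerm _ _ fun c₂ =>
    Fintype.sum_equiv Fin.revPerm _ _ fun k => ?_
  simp only [Fin.revPerm_apply]

theorem yangBaxter_of_sum_le_one {p : ℝ} (hp0 : 0 < p) (hp1 : p < 1) {γ τ : ℂ} (x y : ℂ)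
    (hτ : theta p τ ≠ 0) (hm : theta p (τ - γ) ≠ 0) (hq : theta p (τ + γ) ≠ 0) :
    ∀ a₁ a₂ a₃ b₁ b₂ b₃ : Fin 2, (a₁ : ℕ) + a₂ + a₃ ≤ 1 →
      yangBaxterLeft p γ x y τ a₁ a₂ a₃ b₁ b₂ b₃ =
        yangBaxterRight p γ x y τ a₁ a₂ a₃ b₁ b₂ b₃ := by
  simp only [Fin.forall_fin_two]
  repeat' apply And.intro
  all_goals intro hsum
  all_goals first
    | (exfalso; revert hsum; decide)
    | with_reducible exact yangBaxter_001_001 x y hτ hm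
    | with_reducible exact yangBaxter_001_010 hp0 hp1 x y hτ hm
    | with_reducible exact yangBaxter_001_100 hp0 hp1 x y hτ hm
    | with_reducible exact yangBaxter_010_001 hp0 hp1 x y hτ hm
    | with_reducible exact yangBaxter_010_010 hp0 hp1 x y hτ hm
    | with_reducible exact yangBaxter_010_100 hp0 hp1 x y hτ hm
    | with_reducible exact yangBaxter_100_001 hp0 hp1 x y hτ hm
    | with_reducible exact yangBaxter_100_010 hp0 hp1 x y hτ hm
    | with_reducible exact yangBaxter_100_100 x y hτ hm hq
    | (simp only [yangBaxterLeft, yangBaxterRight, Fin.sum_univ_two, rMatrix_entries,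
        rMatrix_zeros, zero_mul, mul_zero, add_zero, zero_add]; try ring)

/-- The dynamical Yang–Baxter equation. -/
theorem yangBaxter {p : ℝ} (hp0 : 0 < p) (hp1 : p < 1) {γ τ : ℂ} (x y : ℂ)
    (hτ : theta p τ ≠ 0) (hm : theta p (τ - γ) ≠ 0) (hq : theta p (τ + γ) ≠ 0)
    (a₁ a₂ a₃ b₁ b₂ b₃ : Fin 2) :
    yangBaxterLeft p γ x y τ a₁ a₂ a₃ b₁ b₂ b₃ =
      yangBaxterRight p γ x y τ a₁ a₂ a₃ b₁ b₂ b₃ := by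
  by_cases h : (a₁ : ℕ) + a₂ + a₃ ≤ 1
  · exact yangBaxter_of_sum_le_one hp0 hp1 x y hτ hm hq _ _ _ _ _ _ h
  · rw [← neg_neg τ, yangBaxterLeft_neg hp0, yangBaxterRight_neg hp0]
    apply yangBaxter_of_sum_le_one hp0 hp1
    · rwa [theta_neg hp0, neg_ne_zero]
    · rwa [← neg_ne_zero, ← theta_neg hp0, neg_sub, sub_neg_eq_add, add_comm]
    · rwa [← neg_ne_zero, ← theta_neg hp0, neg_add, neg_neg, ← sub_eq_add_neg]
    · simp only [Fin.val_rev]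
      omega

/-! ### The monodromy matrix: recursion on sites, spin conservation, exchange relation. -/

/-- The number of down spins of a state. -/
def downs {L : ℕ} (s : Fin L → Fin 2) : ℕ := ∑ k, (s k : ℕ)

/-- The weight of a state. -/
def totalWeight {L : ℕ} (s : Fin L → Fin 2) : ℂ := ∑ k, weight (s k)

theorem weight_eq (a : Fin 2) : weight a = 1 - 2 * (a : ℕ) := by
  fin_cases a <;> norm_num [weight]

theorem totalWeight_eq {L : ℕ} (s : Fin L → Fin 2) : totalWeight s = L - 2 * downs s := by
  simp [totalWeight, downs, weight_eq, Finset.mul_sum]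

theorem downs_succ {L : ℕ} (s : Fin (L + 1) → Fin 2) :
    downs s = s 0 + downs (Fin.tail s) := by
  simp [downs, Fin.sum_univ_succ, Fin.tail]

theorem totalWeight_succ {L : ℕ} (s : Fin (L + 1) → Fin 2) :
    totalWeight s = weight (s 0) + totalWeight (Fin.tail s) := by
  simp [totalWeight, Fin.sum_univ_succ, Fin.tail]

theorem sum_states_succ {M : Type*} [AddCommMonoid M] {L : ℕ} (f : (Fin (L + 1) → Fin 2) → M) :
    ∑ u, f u = ∑ k, ∑ u, f (Fin.cons k u) := by
  rw [← (Fin.consEquiv fun _ : Fin (L + 1) => Fin 2).sum_comp, Fintype.sum_prod_type]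
  rfl

/-- An operator on `W₀ ⊗ W^{⊗L}`, acting on `W₀ ⊗ W^{⊗(L+1)}` trivially on the first site. -/
def liftSite {L : ℕ} (M : Matrix (Fin 2 × (Fin L → Fin 2)) (Fin 2 × (Fin L → Fin 2)) ℂ) :
    Matrix (Fin 2 × (Fin (L + 1) → Fin 2)) (Fin 2 × (Fin (L + 1) → Fin 2)) ℂ :=
  Matrix.of fun r c => if r.2 0 = c.2 0 then M (r.1, Fin.tail r.2) (c.1, Fin.tail c.2) else 0

theorem liftSite_one {L : ℕ} : liftSite (L := L) 1 = 1 := by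
  ext ⟨a, s⟩ ⟨b, t⟩
  simp only [liftSite, Matrix.of_apply, Matrix.one_apply, Prod.mk.injEq]
  rw [← ite_and]
  refine if_congr ?_ rfl rfl
  constructor
  · rintro ⟨h0, rfl, h⟩
    refine ⟨rfl, ?_⟩
    rw [← Fin.cons_self_tail s, ← Fin.cons_self_tail t, h, h0]
  · rintro ⟨rfl, rfl⟩
    exact ⟨rfl, rfl, rfl⟩

theorem liftSite_mul {L : ℕ}
    (M N : Matrix (Fin 2 × (Fin L → Fin 2)) (Fin 2 × (Fin L → Fin 2)) ℂ) :
    liftSite (M * N) = liftSite M * liftSite N := by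
  ext ⟨a, s⟩ ⟨b, t⟩
  simp only [liftSite, Matrix.of_apply, Matrix.mul_apply, Fintype.sum_prod_type, sum_states_succ,
    Fin.cons_zero, Fin.tail_cons]
  split_ifs with h
  · refine Finset.sum_congr rfl fun c _ => ?_
    rw [Finset.sum_eq_single (t 0)]
    · simp [h]
    · intro k _ hk
      simp [hk]
    · simp
  · symm
    refine Finset.sum_eq_zero fun c _ => Finset.sum_eq_zero fun k _ =>
      Finset.sum_eq_zero fun u _ => ?_
    by_cases hk : s 0 = k
    · rw [if_neg (fun h' => h (hk.trans h')), mul_zero]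
    · rw [if_neg hk, zero_mul]

theorem rFactor_succ (p : ℝ) (γ : ℂ) {L : ℕ} (μ : Fin (L + 1) → ℂ) (x τ : ℂ) (i : Fin L) :
    rFactor p γ μ x τ i.succ = liftSite (rFactor p γ (Fin.tail μ) x τ i) := by
  ext ⟨a, s⟩ ⟨b, t⟩
  simp only [rFactor, liftSite, Matrix.of_apply, Fin.sum_Ioi_succ, Fin.tail]
  rw [← ite_and]
  refine if_congr ?_ rfl rfl
  rw [Fin.forall_fin_succ]
  simp [(Fin.succ_ne_zero _).symm]

theorem monodromy_succ (p : ℝ) (γ : ℂ) {L : ℕ} (μ : Fin (L + 1) → ℂ) (x τ : ℂ) :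
    monodromy p γ μ x τ = rFactor p γ μ x τ 0 * liftSite (monodromy p γ (Fin.tail μ) x τ) := by
  let φ : Matrix (Fin 2 × (Fin L → Fin 2)) (Fin 2 × (Fin L → Fin 2)) ℂ →* _ :=
    { toFun := liftSite, map_one' := liftSite_one, map_mul' := liftSite_mul }
  have h := map_list_prod φ (List.ofFn fun i : Fin L => rFactor p γ (Fin.tail μ) x τ i)
  rw [monodromy, List.ofFn_succ, List.prod_cons]
  congr 1
  refine Eq.trans ?_ h.symm
  rw [List.map_ofFn]
  congr 2
  funext i
  exact rFactor_succ p γ μ x τ i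

/-- The first R-matrix changes no site other than its own, so the state to its right is already the
tail of the row `s`, and this fixes its dynamical parameter. -/
theorem monodromy_succ_apply (p : ℝ) (γ : ℂ) {L : ℕ} (μ : Fin (L + 1) → ℂ) (x τ : ℂ)
    (a b : Fin 2) (s t : Fin (L + 1) → Fin 2) :
    monodromy p γ μ x τ (a, s) (b, t) =
      ∑ c, rMatrix p γ (x - μ 0) (τ - γ * totalWeight (Fin.tail s)) (a, s 0) (c, t 0) *
        monodromy p γ (Fin.tail μ) x τ (c, Fin.tail s) (b, Fin.tail t) := by
  rw [monodromy_succ, Matrix.mul_apply, Fintype.sum_prod_type]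
  refine Finset.sum_congr rfl fun c _ => ?_
  rw [sum_states_succ, Finset.sum_eq_single (t 0), Finset.sum_eq_single (Fin.tail s)]
  · simp only [rFactor, liftSite, Matrix.of_apply, Fin.cons_zero, Fin.tail_cons, if_true]
    rw [if_pos, Fin.sum_Ioi_zero]
    · simp [totalWeight]
    · intro k hk
      obtain ⟨j, rfl⟩ := Fin.exists_succ_eq.2 hk
      rfl
  · intro u _ hu
    rw [rFactor, Matrix.of_apply, if_neg, zero_mul]
    intro h
    refine hu (funext fun k => ?_)
    exact (h k.succ (Fin.succ_ne_zero k)).symm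
  · simp
  · intro k _ hk
    refine Finset.sum_eq_zero fun u _ => ?_
    simp [liftSite, hk]
  · simp

theorem monodromy_zero (p : ℝ) (γ : ℂ) (μ : Fin 0 → ℂ) (x τ : ℂ) (a b : Fin 2)
    (s t : Fin 0 → Fin 2) : monodromy p γ μ x τ (a, s) (b, t) = if a = b then 1 else 0 := by
  simp [monodromy, Matrix.one_apply, Subsingleton.elim s t]

theorem rMatrix_eq_zero (p : ℝ) (γ x τ : ℂ) {a b c d : Fin 2} (h : (a : ℕ) + b ≠ c + d) :
    rMatrix p γ x τ (a, b) (c, d) = 0 := by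
  revert a b c d
  simp only [Fin.forall_fin_two, rMatrix_zeros]
  simp

/-- The monodromy matrix conserves the total number of down spins. -/
theorem monodromy_eq_zero (p : ℝ) (γ : ℂ) {L : ℕ} (μ : Fin L → ℂ) (x τ : ℂ) {a b : Fin 2}
    {s t : Fin L → Fin 2} (h : (a : ℕ) + downs s ≠ b + downs t) :
    monodromy p γ μ x τ (a, s) (b, t) = 0 := by
  induction L generalizing a with
  | zero =>
    rw [monodromy_zero, if_neg]
    rintro rfl
    exact h (by simp [downs])
  | succ L ih =>
    rw [monodromy_succ_apply]
    refine Finset.sum_eq_zero fun c _ => ?_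
    rw [downs_succ, downs_succ] at h
    by_cases h' : (a : ℕ) + s 0 = c + t 0
    · rw [ih, mul_zero]
      omega
    · rw [rMatrix_eq_zero _ _ _ _ h', zero_mul]

theorem weight_add_totalWeight {L : ℕ} {a b : Fin 2} {s t : Fin L → Fin 2}
    (h : (a : ℕ) + downs s = b + downs t) :
    weight a + totalWeight s = weight b + totalWeight t := by
  have h' : ((a : ℕ) : ℂ) + downs s = (b : ℕ) + downs t := by exact_mod_cast h
  rw [weight_eq, weight_eq, totalWeight_eq, totalWeight_eq]
  linear_combination -2 * h'

/-- `τ` avoids all zeros of the dynamical denominators. -/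
def Generic (p : ℝ) (γ τ : ℂ) : Prop := ∀ k : ℤ, theta p (τ + k * γ) ≠ 0

theorem Generic.shift {p : ℝ} {γ τ τ' : ℂ} (h : Generic p γ τ) (k : ℤ) (hk : τ' = τ + k * γ) :
    Generic p γ τ' := fun l => by
  have := h (k + l)
  rwa [Int.cast_add, add_mul, ← add_assoc, ← hk] at this

theorem Generic.sub_totalWeight {p : ℝ} {γ τ : ℂ} (h : Generic p γ τ) {L : ℕ}
    (s : Fin L → Fin 2) : Generic p γ (τ - γ * totalWeight s) :=
  h.shift (2 * downs s - L) (by rw [totalWeight_eq]; push_cast; ring)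

theorem Generic.theta_ne_zero {p : ℝ} {γ τ : ℂ} (h : Generic p γ τ) : theta p τ ≠ 0 := by
  simpa using h 0

theorem Generic.add {p : ℝ} {γ τ : ℂ} (h : Generic p γ τ) : Generic p γ (τ + γ) :=
  h.shift 1 (by simp)

theorem Generic.sub {p : ℝ} {γ τ : ℂ} (h : Generic p γ τ) : Generic p γ (τ - γ) :=
  h.shift (-1) (by push_cast; ring)

/-- This and the next two lemmas only reorder finite sums, separating the first-site weights, to
which Yang–Baxter applies, from the products of monodromy entries on the remaining sites. -/
theorem sum_exchange_left {ι : Type*} [Fintype ι] (F : Fin 2 → Fin 2 → ℂ)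
    (G : Fin 2 → Fin 2 → Fin 2 → ℂ) (H : Fin 2 → Fin 2 → Fin 2 → ι → ℂ) (M N : Fin 2 → ι → ℂ) :
    ∑ c₁, ∑ c₂, F c₁ c₂ * ∑ k, ∑ u, (∑ d, G c₁ d k * M d u) * (∑ e, H c₂ e k u * N e u) =
      ∑ d, ∑ e, ∑ u, (∑ c₁, ∑ c₂, ∑ k, F c₁ c₂ * G c₁ d k * H c₂ e k u) * (M d u * N e u) := by
  simp only [Fin.sum_univ_two, Finset.mul_sum, ← Finset.sum_add_distrib]
  exact Finset.sum_congr rfl fun u _ => by ring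

theorem sum_exchange_mid {ι : Type*} [Fintype ι] (A : Fin 2 → Fin 2 → ℂ)
    (B : Fin 2 → Fin 2 → Fin 2 → ℂ) (C : Fin 2 → Fin 2 → Fin 2 → Fin 2 → ℂ)
    (M N : Fin 2 → ι → ℂ) :
    ∑ d, ∑ e, ∑ u, (∑ c₁, ∑ c₂, ∑ k, A c₂ k * B c₁ c₂ k * C c₁ c₂ d e) * (M d u * N e u) =
      ∑ c₁, ∑ c₂, ∑ k, A c₂ k * B c₁ c₂ k * ∑ d, ∑ e, C c₁ c₂ d e * ∑ u, M d u * N e u := by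
  simp only [Fin.sum_univ_two, Finset.mul_sum, ← Finset.sum_add_distrib]
  exact Finset.sum_congr rfl fun u _ => by ring

theorem sum_exchange_right {ι : Type*} [Fintype ι] (A : Fin 2 → Fin 2 → ℂ)
    (B : Fin 2 → Fin 2 → Fin 2 → ι → ℂ) (M : Fin 2 → Fin 2 → ι → ℂ)
    (N : Fin 2 → Fin 2 → Fin 2 → ι → ℂ) (C : Fin 2 → Fin 2 → ℂ) :
    ∑ d, ∑ e, (∑ k, ∑ u, (∑ c₂, A c₂ k * M c₂ e u) * ∑ c₁, B c₁ k e u * N c₁ d e u) * C d e =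
      ∑ c₁, ∑ c₂, ∑ k, ∑ d, ∑ e, ∑ u, A c₂ k * B c₁ k e u * (M c₂ e u * N c₁ d e u * C d e) := by
  simp only [Fin.sum_univ_two, Finset.sum_mul, ← Finset.sum_add_distrib]
  exact Finset.sum_congr rfl fun u _ => by ring

/-- The exchange relation `R₁₂ T₁ T₂ = T₂ T₁ R₁₂` for the monodromy matrix. -/
theorem monodromy_exchange {p : ℝ} (hp0 : 0 < p) (hp1 : p < 1) {γ τ : ℂ} (x y : ℂ)
    (hτ : Generic p γ τ) {L : ℕ} (μ : Fin L → ℂ) (a₁ a₂ b₁ b₂ : Fin 2) (s t : Fin L → Fin 2) :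
    ∑ c₁, ∑ c₂, rMatrix p γ (x - y) (τ - γ * totalWeight s) (a₁, a₂) (c₁, c₂) *
      ∑ u, monodromy p γ μ x τ (c₁, s) (b₁, u) *
        monodromy p γ μ y (τ - γ * weight b₁) (c₂, u) (b₂, t) =
    ∑ c₁, ∑ c₂, (∑ u, monodromy p γ μ y τ (a₂, s) (c₂, u) *
        monodromy p γ μ x (τ - γ * weight c₂) (a₁, u) (c₁, t)) *
      rMatrix p γ (x - y) τ (c₁, c₂) (b₁, b₂) := by
  induction L generalizing a₁ a₂ with
  | zero =>
    simp only [monodromy_zero, totalWeight, Finset.univ_eq_empty, Finset.sum_empty, mul_zero,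
      sub_zero, Finset.univ_unique, Finset.sum_singleton, Fin.sum_univ_two]
    revert a₁ a₂ b₁ b₂
    simp [Fin.forall_fin_two]
  | succ L ih =>
    simp only [sum_states_succ, monodromy_succ_apply, Fin.cons_zero, Fin.tail_cons]
    set T := τ - γ * totalWeight (Fin.tail s) with hT
    have hTg : Generic p γ T := hτ.sub_totalWeight _
    rw [sum_exchange_left, sum_exchange_right]
    calc _ = ∑ d, ∑ e, ∑ u,
          yangBaxterLeft p γ (x - μ 0) (y - μ 0) T a₁ a₂ (s 0) d e (t 0) *
            (monodromy p γ (Fin.tail μ) x τ (d, Fin.tail s) (b₁, u) *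
              monodromy p γ (Fin.tail μ) y (τ - γ * weight b₁) (e, u) (b₂, Fin.tail t)) := by
          refine Finset.sum_congr rfl fun d _ => Finset.sum_congr rfl fun e _ =>
            Finset.sum_congr rfl fun u _ => ?_
          -- Conservation of down spins turns the dynamical shift seen after the first monodromy
          -- matrix into the shift by `weight d` that Yang–Baxter requires. Where conservation
          -- fails, the term vanishes.
          by_cases h : (d : ℕ) + downs (Fin.tail s) = b₁ + downs u
          · have h1 : τ - γ * weight b₁ - γ * totalWeight u = T - γ * weight d := by
              linear_combination γ * weight_add_totalWeight h
            have h2 : τ - γ * totalWeight s = T - γ * weight (s 0) := by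
              rw [totalWeight_succ, hT]; ring
            rw [yangBaxterLeft, h1, h2, sub_sub_sub_cancel_right]
          · rw [monodromy_eq_zero _ _ _ _ _ h, zero_mul, mul_zero, mul_zero]
      _ = ∑ d, ∑ e, ∑ u,
          yangBaxterRight p γ (x - μ 0) (y - μ 0) T a₁ a₂ (s 0) d e (t 0) *
            (monodromy p γ (Fin.tail μ) x τ (d, Fin.tail s) (b₁, u) *
              monodromy p γ (Fin.tail μ) y (τ - γ * weight b₁) (e, u) (b₂, Fin.tail t)) := by
          simp only [yangBaxter hp0 hp1 _ _ hTg.theta_ne_zero hTg.sub.theta_ne_zero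
            hTg.add.theta_ne_zero]
      _ = _ := by
          simp only [yangBaxterRight, sub_sub_sub_cancel_right]
          rw [sum_exchange_mid]
          refine Finset.sum_congr rfl fun c₁ _ => Finset.sum_congr rfl fun c₂ _ =>
            Finset.sum_congr rfl fun k _ => ?_
          rw [ih]
          simp only [Finset.mul_sum, Finset.sum_mul]
          refine Finset.sum_congr rfl fun d _ => Finset.sum_congr rfl fun e _ =>
            Finset.sum_congr rfl fun u _ => ?_
          by_cases h : (c₂ : ℕ) + downs (Fin.tail s) = e + downs u
          · have h1 : τ - γ * weight e - γ * totalWeight u = T - γ * weight c₂ := by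
              linear_combination γ * weight_add_totalWeight h
            rw [h1]
          · rw [monodromy_eq_zero _ _ _ _ _ h, zero_mul, zero_mul, mul_zero, mul_zero]

/-! ### Density of generic parameters and continuity in the spectral parameter. -/

/-- By the identity theorem, vanishing on an open set would force vanishing everywhere. That theta
is not identically zero is taken as a hypothesis; in each use a nonvanishing denominator supplies
it. -/
theorem dense_theta_ne_zero {p : ℝ} (hp0 : 0 < p) (hp1 : p < 1) (h : ∃ z, theta p z ≠ 0) :
    Dense {z | theta p z ≠ 0} := by
  obtain ⟨z, hz⟩ := h
  have han : AnalyticOnNhd ℂ (theta p) Set.univ := fun w _ =>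
    (differentiable_theta hp0 hp1).analyticAt w
  rw [← Set.compl_ofPred, ← interior_eq_empty_iff_dense_compl, Set.eq_empty_iff_forall_notMem]
  intro w hw
  refine hz ?_
  have hev : theta p =ᶠ[nhds w] 0 := mem_interior_iff_mem_nhds.1 hw
  exact congrFun (han.eq_of_eventuallyEq analyticOnNhd_const hev) z

theorem isOpen_theta_ne_zero {p : ℝ} (hp0 : 0 < p) (hp1 : p < 1) :
    IsOpen {z | theta p z ≠ 0} :=
  isOpen_ne_fun (differentiable_theta hp0 hp1).continuous continuous_const

theorem dense_theta_add_ne_zero {p : ℝ} (hp0 : 0 < p) (hp1 : p < 1) (h : ∃ z, theta p z ≠ 0)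
    (c : ℂ) : Dense {z | theta p (z + c) ≠ 0} :=
  (dense_theta_ne_zero hp0 hp1 h).preimage (Homeomorph.addRight c).isOpenMap

/-- Baire's theorem: a countable intersection of dense open sets. -/
theorem dense_generic {p : ℝ} (hp0 : 0 < p) (hp1 : p < 1) (h : ∃ z, theta p z ≠ 0) (γ : ℂ) :
    Dense {τ | Generic p γ τ} := by
  have : {τ | Generic p γ τ} = ⋂ k : ℤ, {τ | theta p (τ + k * γ) ≠ 0} := by
    ext; simp [Generic]
  rw [this]
  exact dense_iInter_of_isOpen
    (fun k => (isOpen_theta_ne_zero hp0 hp1).preimage (continuous_add_const _))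
    fun k => dense_theta_add_ne_zero hp0 hp1 h _

theorem continuous_rMatrix_spectral {p : ℝ} (hp0 : 0 < p) (hp1 : p < 1) (γ τ : ℂ) (r c) :
    Continuous fun x => rMatrix p γ x τ r c := by
  have hθ := (differentiable_theta hp0 hp1).continuous
  obtain ⟨a, b⟩ := r
  obtain ⟨c, d⟩ := c
  revert a b c d
  simp only [Fin.forall_fin_two, rMatrix_entries, rMatrix_zeros, div_eq_mul_inv]
  refine ⟨⟨⟨⟨?_, ?_⟩, ?_, ?_⟩, ⟨?_, ?_⟩, ?_, ?_⟩, ⟨⟨?_, ?_⟩, ?_, ?_⟩, ⟨?_, ?_⟩, ?_, ?_⟩ <;> fun_prop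

theorem continuous_monodromy_spectral {p : ℝ} (hp0 : 0 < p) (hp1 : p < 1) (γ τ : ℂ) {L : ℕ}
    (μ : Fin L → ℂ) (r c) : Continuous fun x => monodromy p γ μ x τ r c := by
  obtain ⟨a, s⟩ := r
  obtain ⟨b, t⟩ := c
  induction L generalizing a with
  | zero => simp only [monodromy_zero]; exact continuous_const
  | succ L ih =>
    simp only [monodromy_succ_apply]
    refine continuous_finsetSum _ fun c _ => Continuous.mul ?_ (ih _ _ _ _)
    exact (continuous_rMatrix_spectral hp0 hp1 _ _ _ _).comp (continuous_id.sub continuous_const)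

/-! ### Commutation rules for `B` and `D`. -/

/-- The operator `D(x, τ)`: the lower right block of the monodromy matrix. -/
def opD (p : ℝ) (γ : ℂ) {L : ℕ} (μ : Fin L → ℂ) (x τ : ℂ) :
    Matrix (Fin L → Fin 2) (Fin L → Fin 2) ℂ :=
  Matrix.of fun s t => monodromy p γ μ x τ (1, s) (1, t)

theorem opB_eq_zero (p : ℝ) (γ : ℂ) {L : ℕ} (μ : Fin L → ℂ) (x τ : ℂ) {s t : Fin L → Fin 2}
    (h : downs s ≠ downs t + 1) : opB p γ μ x τ s t = 0 :=
  monodromy_eq_zero p γ μ x τ (by simpa [add_comm] using h)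

theorem opD_eq_zero (p : ℝ) (γ : ℂ) {L : ℕ} (μ : Fin L → ℂ) (x τ : ℂ) {s t : Fin L → Fin 2}
    (h : downs s ≠ downs t) : opD p γ μ x τ s t = 0 :=
  monodromy_eq_zero p γ μ x τ (by simpa using h)

section Exchange

variable {p : ℝ} (hp0 : 0 < p) (hp1 : p < 1) {γ τ : ℂ} (hτ : Generic p γ τ) {L : ℕ}
  (μ : Fin L → ℂ) (x y : ℂ)
include hp0 hp1 hτ

theorem opB_mul_opB :
    opB p γ μ x τ * opB p γ μ y (τ + γ) = opB p γ μ y τ * opB p γ μ x (τ + γ) := by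
  ext s t
  simp only [Matrix.mul_apply, opB, Matrix.of_apply]
  -- The exchange relation gives the claim only up to the factor `[x - y + γ]`. It is cancelled
  -- where nonzero, and the remaining `x` are reached by continuity.
  have hd := dense_theta_add_ne_zero hp0 hp1 ⟨_, hτ.theta_ne_zero⟩ (γ - y)
  refine congrFun (Continuous.ext_on hd (f := fun x => ∑ u, monodromy p γ μ x τ (0, s) (1, u) *
      monodromy p γ μ y (τ + γ) (0, u) (1, t)) (g := fun x => ∑ u,
      monodromy p γ μ y τ (0, s) (1, u) * monodromy p γ μ x (τ + γ) (0, u) (1, t)) ?_ ?_ ?_) x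
  · exact continuous_finsetSum _ fun u _ =>
      (continuous_monodromy_spectral hp0 hp1 _ _ _ _ _).mul continuous_const
  · exact continuous_finsetSum _ fun u _ =>
      continuous_const.mul (continuous_monodromy_spectral hp0 hp1 _ _ _ _ _)
  · intro z hz
    have h := monodromy_exchange hp0 hp1 z y hτ μ 0 0 1 1 s t
    simp only [Fin.sum_univ_two, rMatrix_entries, rMatrix_zeros, sub_weight_one, zero_mul,
      mul_zero, add_zero, zero_add] at h
    rw [mul_comm] at h
    refine mul_right_cancel₀ ?_ h
    rwa [show z - y + γ = z + (γ - y) by ring]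

/-- The left R-matrix of the exchange relation is evaluated on the weight space of the row `s`, so
its dynamical parameter is `T` and depends on the sector. -/
theorem opD_mul_opB (s t : Fin L → Fin 2) {T : ℂ} (hT : T = τ - γ * totalWeight s) :
    theta p (T + γ) * theta p (x - y) * (opD p γ μ x τ * opB p γ μ y (τ + γ)) s t =
      theta p T * theta p (x - y + γ) * (opB p γ μ y τ * opD p γ μ x (τ + γ)) s t -
        theta p (T + (x - y)) * theta p γ * (opB p γ μ x τ * opD p γ μ y (τ + γ)) s t := by
  have h := monodromy_exchange hp0 hp1 x y hτ μ 1 0 1 1 s t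
  have hT0 : theta p T ≠ 0 := hT ▸ (hτ.sub_totalWeight s).theta_ne_zero
  simp only [Fin.sum_univ_two, rMatrix_entries, rMatrix_zeros, sub_weight_one, zero_mul,
    mul_zero, add_zero, zero_add, ← hT] at h
  simp only [Matrix.mul_apply, opB, opD, Matrix.of_apply]
  field_simp at h
  linear_combination h

theorem opD_mul_opB_mulVec (v : (Fin L → Fin 2) → ℂ) (s : Fin L → Fin 2) {T : ℂ}
    (hT : T = τ - γ * totalWeight s) :
    theta p (T + γ) * theta p (x - y) * (opD p γ μ x τ *ᵥ (opB p γ μ y (τ + γ) *ᵥ v)) s =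
      theta p T * theta p (x - y + γ) * (opB p γ μ y τ *ᵥ (opD p γ μ x (τ + γ) *ᵥ v)) s -
        theta p (T + (x - y)) * theta p γ *
          (opB p γ μ x τ *ᵥ (opD p γ μ y (τ + γ) *ᵥ v)) s := by
  simp only [Matrix.mulVec_mulVec]
  simp only [Matrix.mulVec, dotProduct, Finset.mul_sum, ← Finset.sum_sub_distrib, ← mul_assoc,
    ← sub_mul, opD_mul_opB hp0 hp1 hτ μ x y s _ hT]

end Exchange

/-! ### Bethe vectors and their symmetry. -/

/-- The vector `B(x₁, τ + γ) ⋯ B(xₙ, τ + nγ) |0⟩`. -/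
def betheVector (p : ℝ) (γ : ℂ) {L : ℕ} (μ : Fin L → ℂ) (τ : ℂ) {n : ℕ} (x : Fin n → ℂ) :
    (Fin L → Fin 2) → ℂ :=
  (List.ofFn fun j : Fin n => opB p γ μ (x j) (τ + ((j : ℕ) + 1 : ℂ) * γ)).prod *ᵥ ketZero L

theorem partitionFunction_eq (p : ℝ) (γ : ℂ) {L : ℕ} (μ : Fin L → ℂ) (τ : ℂ) (x : Fin L → ℂ) :
    partitionFunction p γ μ τ x = braZeroBar L ⬝ᵥ betheVector p γ μ τ x := rfl

theorem betheVector_zero (p : ℝ) (γ : ℂ) {L : ℕ} (μ : Fin L → ℂ) (τ : ℂ) (x : Fin 0 → ℂ) :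
    betheVector p γ μ τ x = ketZero L := by
  simp [betheVector]

theorem betheVector_cons (p : ℝ) (γ : ℂ) {L : ℕ} (μ : Fin L → ℂ) (τ : ℂ) {n : ℕ} (y : ℂ)
    (x : Fin n → ℂ) :
    betheVector p γ μ τ (Fin.cons y x : Fin (n + 1) → ℂ) =
      opB p γ μ y (τ + γ) *ᵥ betheVector p γ μ (τ + γ) x := by
  have h (j : Fin n) :
      τ + (((j.succ : Fin (n + 1)) : ℕ) + 1 : ℂ) * γ = τ + γ + ((j : ℕ) + 1 : ℂ) * γ := by
    rw [Fin.val_succ]; push_cast; ring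
  simp only [betheVector, List.ofFn_succ, List.prod_cons, ← Matrix.mulVec_mulVec, Fin.cons_zero,
    Fin.cons_succ, h]
  simp

/-- The vector `B(x₁, τ + γ) ⋯ B(xₙ, τ + nγ) |0⟩` for a list of spectral parameters. -/
def betheList (p : ℝ) (γ : ℂ) {L : ℕ} (μ : Fin L → ℂ) : List ℂ → ℂ → (Fin L → Fin 2) → ℂ
  | [], _ => ketZero L
  | y :: l, τ => opB p γ μ y (τ + γ) *ᵥ betheList p γ μ l (τ + γ)

theorem betheVector_eq_betheList (p : ℝ) (γ : ℂ) {L : ℕ} (μ : Fin L → ℂ) (τ : ℂ) {n : ℕ}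
    (x : Fin n → ℂ) : betheVector p γ μ τ x = betheList p γ μ (List.ofFn x) τ := by
  induction n generalizing τ with
  | zero => rw [betheVector_zero, List.ofFn_zero, betheList]
  | succ n ih =>
    rw [← Fin.cons_self_tail x, betheVector_cons, ih, List.ofFn_cons, betheList]

/-- List permutations are generated by adjacent swaps, and a swap is the commutation of two `B`'s
whose dynamical parameters stay in place. -/
theorem betheList_perm {p : ℝ} (hp0 : 0 < p) (hp1 : p < 1) {γ τ : ℂ} (hτ : Generic p γ τ) {L : ℕ}
    (μ : Fin L → ℂ) {l l' : List ℂ} (h : l.Perm l') :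
    betheList p γ μ l τ = betheList p γ μ l' τ := by
  induction h generalizing τ with
  | nil => rfl
  | cons y _ ih => rw [betheList, betheList, ih hτ.add]
  | swap y z l =>
    simp only [betheList, Matrix.mulVec_mulVec, opB_mul_opB hp0 hp1 hτ.add μ z y]
  | trans _ _ ih₁ ih₂ => rw [ih₁ hτ, ih₂ hτ]

theorem betheVector_comp_perm {p : ℝ} (hp0 : 0 < p) (hp1 : p < 1) {γ τ : ℂ} (hτ : Generic p γ τ)
    {L : ℕ} (μ : Fin L → ℂ) {n : ℕ} (x : Fin n → ℂ) (σ : Equiv.Perm (Fin n)) :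
    betheVector p γ μ τ (x ∘ σ) = betheVector p γ μ τ x := by
  rw [betheVector_eq_betheList, betheVector_eq_betheList]
  exact betheList_perm hp0 hp1 hτ μ (σ.ofFn_comp_perm x)

theorem betheVector_cons_update {p : ℝ} (hp0 : 0 < p) (hp1 : p < 1) {γ τ : ℂ}
    (hτ : Generic p γ τ) {L : ℕ} (μ : Fin L → ℂ) {n : ℕ} (x : Fin n → ℂ) (i : Fin n) (y z : ℂ) :
    betheVector p γ μ τ (Fin.cons y (Function.update x i z) : Fin (n + 1) → ℂ) =
      betheVector p γ μ τ (Fin.cons z (Function.update x i y) : Fin (n + 1) → ℂ) := by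
  rw [← betheVector_comp_perm hp0 hp1 hτ μ _ (Equiv.swap 0 i.succ)]
  congr 1
  funext j
  refine Fin.cases ?_ (fun j => ?_) j
  · simp
  · by_cases hj : j = i
    · subst hj
      simp [Function.update_of_ne (Fin.succ_ne_zero j).symm]
    · rw [Function.comp_apply, Equiv.swap_apply_of_ne_of_ne (Fin.succ_ne_zero j)
        (by simpa using hj)]
      simp [hj]

/-! ### Extremal states and their `D` eigenvalues. -/

theorem ketZero_eq {L : ℕ} (s : Fin L → Fin 2) : ketZero L s = if s = 0 then 1 else 0 := by
  rw [ketZero]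
  split_ifs with h
  · simp [h]
  · obtain ⟨i, hi⟩ := Function.ne_iff.1 h
    refine Finset.prod_eq_zero (Finset.mem_univ i) ?_
    have : s i = 1 := by have := hi; simp only [Pi.zero_apply] at this; omega
    simp [this]

theorem braZeroBar_eq {L : ℕ} (s : Fin L → Fin 2) :
    braZeroBar L s = if s = 1 then 1 else 0 := by
  rw [braZeroBar]
  split_ifs with h
  · simp [h]
  · obtain ⟨i, hi⟩ := Function.ne_iff.1 h
    refine Finset.prod_eq_zero (Finset.mem_univ i) ?_
    have : s i = 0 := by have := hi; simp only [Pi.one_apply] at this; omega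
    simp [this]

theorem partitionFunction_eq_betheVector_one (p : ℝ) (γ : ℂ) {L : ℕ} (μ : Fin L → ℂ) (τ : ℂ)
    (x : Fin L → ℂ) : partitionFunction p γ μ τ x = betheVector p γ μ τ x 1 := by
  simp [partitionFunction_eq, dotProduct, braZeroBar_eq]

theorem downs_eq_zero {L : ℕ} {s : Fin L → Fin 2} : downs s = 0 ↔ s = 0 := by
  simp only [downs, Finset.sum_eq_zero_iff, Finset.mem_univ, true_implies, funext_iff,
    Pi.zero_apply, Fin.val_eq_zero_iff]

theorem downs_one {L : ℕ} : downs (1 : Fin L → Fin 2) = L := by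
  simp [downs]

theorem eq_one_of_downs {L : ℕ} {s : Fin L → Fin 2} (h : downs s = L) : s = 1 := by
  have hle : ∀ k ∈ Finset.univ, ((s k : Fin 2) : ℕ) ≤ 1 := fun k _ => by omega
  have h' : ∑ k, ((s k : Fin 2) : ℕ) = ∑ k : Fin L, 1 := by simpa [downs] using h
  have := (Finset.sum_eq_sum_iff_of_le hle).1 h'
  funext k
  have := this k (Finset.mem_univ k)
  simp only [Pi.one_apply]
  omega

/-- A site with `m` sites to its right contributes `[τ - (m-1)γ][x - μ]/[τ - mγ]`, and the dynamical
factors telescope. -/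
theorem monodromy_vacuum {p : ℝ} {γ τ : ℂ} (hτ : Generic p γ τ) {L : ℕ} (μ : Fin L → ℂ) (x : ℂ) :
    monodromy p γ μ x τ (1, 0) (1, 0) =
      theta p (τ + γ) / theta p (τ + (1 - L) * γ) * ∏ j, theta p (x - μ j) := by
  induction L with
  | zero =>
    have := hτ.add.theta_ne_zero
    simp [monodromy_zero, this]
  | succ L ih =>
    have h0 : totalWeight (0 : Fin L → Fin 2) = L := by simp [totalWeight, weight]
    have h1 : Fin.tail (0 : Fin (L + 1) → Fin 2) = 0 := rfl
    have h2 : theta p (τ - γ * L + γ) ≠ 0 :=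
      (hτ.shift (1 - L) (by push_cast; ring)).theta_ne_zero
    have h3 : theta p (τ - γ * L) ≠ 0 := (hτ.shift (-L) (by push_cast; ring)).theta_ne_zero
    rw [monodromy_succ_apply, h1, Fin.sum_univ_two, ih, Pi.zero_apply, h0, Fin.prod_univ_succ,
      show τ + (1 - L) * γ = τ - γ * L + γ by ring,
      show τ + (1 - ((L + 1 : ℕ) : ℂ)) * γ = τ - γ * L by push_cast; ring]
    simp only [rMatrix_entries, rMatrix_zeros, zero_mul, zero_add, Fin.tail]
    field_simp

theorem monodromy_vacuum_bar (p : ℝ) (γ τ : ℂ) {L : ℕ} (μ : Fin L → ℂ) (x : ℂ) :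
    monodromy p γ μ x τ (1, 1) (1, 1) = ∏ j, theta p (x - μ j + γ) := by
  induction L with
  | zero => simp [monodromy_zero]
  | succ L ih =>
    have h1 : Fin.tail (1 : Fin (L + 1) → Fin 2) = 1 := rfl
    rw [monodromy_succ_apply, h1, Fin.sum_univ_two, ih, Pi.one_apply, Fin.prod_univ_succ]
    simp only [rMatrix_entries, rMatrix_zeros, zero_mul, zero_add, Fin.tail]

theorem opD_mulVec_one (p : ℝ) (γ τ : ℂ) {L : ℕ} (μ : Fin L → ℂ) (x : ℂ)
    (v : (Fin L → Fin 2) → ℂ) : (opD p γ μ x τ *ᵥ v) 1 = coeffM p γ μ x * v 1 := by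
  rw [Matrix.mulVec, dotProduct, Finset.sum_eq_single 1]
  · rw [coeffM, ← monodromy_vacuum_bar p γ τ]; rfl
  · intro t _ ht
    rw [opD_eq_zero, zero_mul]
    intro h
    exact ht (eq_one_of_downs (by rw [← h, downs_one]))
  · simp

/-- Needed because the formula for `D` on a Bethe vector holds sector by sector: its coefficients
depend on the number of down spins. -/
theorem opB_mulVec_congr (p : ℝ) (γ : ℂ) {L : ℕ} (μ : Fin L → ℂ) (x τ : ℂ)
    {s : Fin L → Fin 2} {n : ℕ} (hs : downs s = n + 1) {v w : (Fin L → Fin 2) → ℂ}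
    (h : ∀ u, downs u = n → v u = w u) : (opB p γ μ x τ *ᵥ v) s = (opB p γ μ x τ *ᵥ w) s := by
  simp only [Matrix.mulVec, dotProduct]
  refine Finset.sum_congr rfl fun u _ => ?_
  by_cases hu : downs u = n
  · rw [h u hu]
  · rw [opB_eq_zero, zero_mul, zero_mul]
    omega

theorem prod_erase_zero {M : Type*} [CommMonoid M] {n : ℕ} (f : Fin (n + 1) → M) :
    ∏ j ∈ Finset.univ.erase 0, f j = ∏ j : Fin n, f j.succ := by
  rw [Fin.univ_succ, Finset.erase_cons, Finset.prod_map]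
  rfl

theorem prod_erase_succ {M : Type*} [CommMonoid M] {n : ℕ} (f : Fin (n + 1) → M) (i : Fin n) :
    ∏ j ∈ Finset.univ.erase i.succ, f j = f 0 * ∏ j ∈ Finset.univ.erase i, f j.succ := by
  rw [Fin.univ_succ, Finset.erase_cons_of_ne _ (Fin.succ_ne_zero i).symm, Finset.prod_cons]
  congr 1
  exact (congrArg (fun t => ∏ j ∈ t, f j) (Finset.map_erase (Fin.succEmb n) _ i).symm).trans
    (Finset.prod_map _ _ _)

theorem opD_mulVec_ketZero {p : ℝ} {γ τ : ℂ} (hτ : Generic p γ τ) {L : ℕ} (μ : Fin L → ℂ)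
    (x : ℂ) {s : Fin L → Fin 2} (hs : downs s = 0) :
    (opD p γ μ x τ *ᵥ ketZero L) s =
      theta p (τ + γ) / theta p (τ + (1 - L) * γ) * (∏ j, theta p (x - μ j)) * ketZero L s := by
  obtain rfl := downs_eq_zero.1 hs
  rw [Matrix.mulVec, dotProduct, ← monodromy_vacuum hτ]
  simp [ketZero_eq, opD]

/-! ### Moving `D` through the product of `B`'s. -/

/-- The scalar identity behind the induction step of the Bethe expansion. -/
theorem theta_exchange {p : ℝ} (hp0 : 0 < p) (hp1 : p < 1) (T γ x₀ x₁ x₂ : ℂ) :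
    theta p T * theta p (x₀ - x₁ + γ) * (theta p (T - γ + (x₀ - x₂)) * theta p (x₁ - x₂)) -
      theta p (T + (x₀ - x₁)) * theta p γ * (theta p (T - γ + (x₁ - x₂)) * theta p (x₀ - x₂)) +
      theta p (T + (x₀ - x₂)) * theta p (x₂ - x₁ + γ) *
        (theta p (T - γ) * theta p (x₀ - x₁)) = 0 := by
  have h := theta_weierstrass hp0 hp1 ((x₀ - x₁ + T + γ) / 2) ((T - γ - (x₀ - x₁)) / 2)
    ((x₀ - x₁ + T - γ) / 2) ((x₀ - x₁ + T - γ) / 2 + (x₁ - x₂))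
    (u₁ := T) (u₂ := x₀ - x₁ + γ) (u₃ := T - γ + (x₀ - x₂)) (u₄ := -(x₁ - x₂))
    (v₁ := T + (x₀ - x₁)) (v₂ := γ) (v₃ := T - γ + (x₁ - x₂)) (v₄ := -(x₀ - x₂))
    (w₁ := T + (x₀ - x₂)) (w₂ := x₂ - x₁ + γ) (w₃ := T - γ) (w₄ := -(x₀ - x₁))
  simp only [theta_neg hp0] at h
  linear_combination -h

theorem sum_combine {ι : Type*} [Fintype ι] {α β δ : ℂ} {A B C D : ι → ℂ}
    (h : ∀ i, α * A i - β * B i = δ * (C i * D i)) (P Q V : ι → ℂ) :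
    α * ∑ i, A i * P i * Q i * V i - β * ∑ i, B i * P i * Q i * V i =
      δ * ∑ i, C i * P i * (D i * Q i) * V i := by
  simp only [Finset.mul_sum, ← Finset.sum_sub_distrib]
  exact Finset.sum_congr rfl fun i _ => by linear_combination P i * Q i * V i * h i

/-- The action of `D` on the vectors `B(x₁, τ + γ) ⋯ B(xₙ, τ + nγ) |0⟩`. -/
theorem opD_mulVec_betheVector {p : ℝ} (hp0 : 0 < p) (hp1 : p < 1) {γ τ : ℂ}
    (hτ : Generic p γ τ) {L : ℕ} (μ : Fin L → ℂ) {n : ℕ} (x : Fin n → ℂ) (x₀ : ℂ)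
    (hx₀ : ∀ i, theta p (x₀ - x i) ≠ 0) (hx : ∀ i j, i ≠ j → theta p (x i - x j) ≠ 0)
    {s : Fin L → Fin 2} (hs : downs s = n) {S T : ℂ} (hS : S = τ + (n + 2) * γ)
    (hT : T = τ + (2 * n + 1 - L) * γ) :
    (opD p γ μ x₀ (τ + γ) *ᵥ betheVector p γ μ (τ + γ) x) s =
      theta p S / theta p (T + γ) * ((∏ j, theta p (x₀ - μ j)) *
        ∏ j, theta p (x₀ - x j + γ) / theta p (x₀ - x j)) * betheVector p γ μ τ x s -
      ∑ i, theta p γ * theta p S * theta p (T + (x₀ - x i)) /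
          (theta p (x₀ - x i) * theta p (T + γ) * theta p T) * (∏ j, theta p (x i - μ j)) *
          (∏ j ∈ Finset.univ.erase i, theta p (x i - x j + γ) / theta p (x i - x j)) *
        betheVector p γ μ τ (Function.update x i x₀) s := by
  induction n generalizing τ x₀ s S T with
  | zero =>
    simp only [betheVector_zero, Finset.univ_eq_empty, Finset.sum_empty, Finset.prod_empty,
      sub_zero, mul_one]
    rw [opD_mulVec_ketZero hτ.add μ x₀ hs, hS, hT]
    congr 4 <;> push_cast <;> ring_nf
  | succ n ih =>
    obtain ⟨x₁, x, rfl⟩ : ∃ (x₁ : ℂ) (x' : Fin n → ℂ), x = (Fin.cons x₁ x' : Fin (n + 1) → ℂ) :=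
      ⟨x 0, Fin.tail x, (Fin.cons_self_tail x).symm⟩
    have hT' : T = τ + γ - γ * totalWeight s := by
      rw [totalWeight_eq, hs, hT]; push_cast; ring
    have hT0 : theta p T ≠ 0 := hT' ▸ (hτ.add.sub_totalWeight s).theta_ne_zero
    have hTp : theta p (T + γ) ≠ 0 := hT' ▸ (hτ.add.sub_totalWeight s).add.theta_ne_zero
    have hTm : theta p (T - γ) ≠ 0 := hT' ▸ (hτ.add.sub_totalWeight s).sub.theta_ne_zero
    have h01 : theta p (x₀ - x₁) ≠ 0 := by simpa using hx₀ 0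
    have h0 : ∀ i, theta p (x₀ - x i) ≠ 0 := fun i => by simpa using hx₀ i.succ
    have h1 : ∀ i, theta p (x₁ - x i) ≠ 0 := fun i => by
      simpa using hx 0 i.succ (Fin.succ_ne_zero i).symm
    have h1' : ∀ i, theta p (x i - x₁) = -theta p (x₁ - x i) := fun i => by
      rw [← theta_neg hp0, neg_sub]
    have hxx : ∀ i j, i ≠ j → theta p (x i - x j) ≠ 0 := fun i j hij => by
      simpa using hx i.succ j.succ (by simpa using hij)
    -- Passing to `n` parameters at `τ + γ` leaves `S` unchanged and lowers `T` by `γ`.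
    have hSn : S = τ + γ + (n + 2) * γ := by rw [hS]; push_cast; ring
    have hTn : T - γ = τ + γ + (2 * n + 1 - L) * γ := by rw [hT]; push_cast; ring
    have key := opD_mul_opB_mulVec hp0 hp1 hτ.add μ x₀ x₁ (betheVector p γ μ (τ + γ + γ) x) s hT'
    -- The induction hypothesis under one further `B`. It is used for `(x₀, x₁)`, where `D` keeps
    -- its argument, and for `(x₁, x₀)`, where the arguments are exchanged.
    have hmain (y z : ℂ) (hy : ∀ i, theta p (y - x i) ≠ 0) :
        (opB p γ μ z (τ + γ) *ᵥ (opD p γ μ y (τ + γ + γ) *ᵥ betheVector p γ μ (τ + γ + γ) x)) s =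
        theta p S / theta p T * ((∏ j, theta p (y - μ j)) *
          ∏ j, theta p (y - x j + γ) / theta p (y - x j)) *
            betheVector p γ μ τ (Fin.cons z x : Fin (n + 1) → ℂ) s -
        ∑ i, theta p γ * theta p S * theta p (T - γ + (y - x i)) /
            (theta p (y - x i) * theta p T * theta p (T - γ)) * (∏ j, theta p (x i - μ j)) *
            (∏ j ∈ Finset.univ.erase i, theta p (x i - x j + γ) / theta p (x i - x j)) *
          betheVector p γ μ τ (Fin.cons z (Function.update x i y) : Fin (n + 1) → ℂ) s := by
      rw [opB_mulVec_congr p γ μ z (τ + γ) hs fun u hu =>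
        ih hτ.add x y hy hxx hu hSn hTn]
      simp only [betheVector_cons, sub_add_cancel]
      simp only [Matrix.mulVec, dotProduct, mul_sub, Finset.sum_sub_distrib, Finset.mul_sum]
      rw [Finset.sum_comm]
      congr 1
      · exact Finset.sum_congr rfl fun u _ => by ring
      · exact Finset.sum_congr rfl fun i _ => Finset.sum_congr rfl fun u _ => by ring
    rw [hmain x₀ x₁ h0, hmain x₁ x₀ h1] at key
    rw [betheVector_cons]
    refine mul_left_cancel₀ (mul_ne_zero hTp h01) (key.trans ?_)
    -- The term with `x₀` in place of a later parameter `x i` arises from both branches; this adds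
    -- the two coefficients.
    have hterm (i : Fin n) :
        theta p T * theta p (x₀ - x₁ + γ) *
          (theta p γ * theta p S * theta p (T - γ + (x₀ - x i)) /
            (theta p (x₀ - x i) * theta p T * theta p (T - γ))) -
        theta p (T + (x₀ - x₁)) * theta p γ *
          (theta p γ * theta p S * theta p (T - γ + (x₁ - x i)) /
            (theta p (x₁ - x i) * theta p T * theta p (T - γ))) =
        theta p (T + γ) * theta p (x₀ - x₁) *
          (theta p γ * theta p S * theta p (T + (x₀ - x i)) /
            (theta p (x₀ - x i) * theta p (T + γ) * theta p T) *
            (theta p (x i - x₁ + γ) / theta p (x i - x₁))) := by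
      have hi0 := h0 i
      have hi1 := h1 i
      rw [h1']
      field_simp
      linear_combination theta p γ * theta p S * theta_exchange hp0 hp1 T γ x₀ x₁ (x i)
    rw [Fin.sum_univ_succ]
    simp only [Fin.cons_zero, Fin.cons_succ, Fin.prod_univ_succ (n := n), prod_erase_zero,
      prod_erase_succ, Fin.update_cons_zero, ← Fin.cons_update]
    -- Symmetry identifies the vectors of the two branches, making their coefficients comparable.
    simp only [betheVector_cons_update hp0 hp1 hτ μ x _ x₀ x₁]
    have hsum := sum_combine hterm (fun i => ∏ j, theta p (x i - μ j))
      (fun i => ∏ j ∈ Finset.univ.erase i, theta p (x i - x j + γ) / theta p (x i - x j))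
      (fun i => betheVector p γ μ τ (Fin.cons x₁ (Function.update x i x₀) : Fin (n + 1) → ℂ) s)
    have hfirst (P V : ℂ) : theta p T * theta p (x₀ - x₁ + γ) * (theta p S / theta p T * P * V) =
        theta p (T + γ) * theta p (x₀ - x₁) * (theta p S / theta p (T + γ) *
          (theta p (x₀ - x₁ + γ) / theta p (x₀ - x₁) * P) * V) := by
      field_simp
    have hsecond (P V : ℂ) :
        theta p (T + (x₀ - x₁)) * theta p γ * (theta p S / theta p T * P * V) =
        theta p (T + γ) * theta p (x₀ - x₁) * (theta p γ * theta p S * theta p (T + (x₀ - x₁)) /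
          (theta p (x₀ - x₁) * theta p (T + γ) * theta p T) * P * V) := by
      field_simp
    rw [mul_sub, hfirst, mul_sub (theta p (T + (x₀ - x₁)) * theta p γ), hsecond]
    linear_combination -hsum

theorem functional_equation_of_generic {p : ℝ} (hp0 : 0 < p) (hp1 : p < 1) {γ τ : ℂ}
    (hτ : Generic p γ τ) {L : ℕ} (μ x : Fin L → ℂ) (x₀ : ℂ)
    (hx₀ : ∀ i, theta p (x₀ - x i) ≠ 0) (hx : ∀ i j, i ≠ j → theta p (x i - x j) ≠ 0) :
    coeffM p γ μ x₀ * partitionFunction p γ μ (τ + γ) x +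
      (coeffNZero p γ μ x x₀ * partitionFunction p γ μ τ x +
        ∑ i, coeffN p γ τ μ x x₀ i * partitionFunction p γ μ τ (Function.update x i x₀)) = 0 := by
  have hS : theta p (τ + (L + 2) * γ) ≠ 0 := by simpa using hτ (L + 2)
  have h := opD_mulVec_betheVector hp0 hp1 hτ μ x x₀ hx₀ hx downs_one
    -- On the all-down state `n = L`, hence `S = T + γ`: the prefactor of the first term is 1 and
    -- `[S]` cancels in the others.
    (S := τ + (L + 2) * γ) (T := τ + (L + 1) * γ) rfl (by ring)
  rw [opD_mulVec_one, show τ + (L + 1) * γ + γ = τ + (L + 2) * γ by ring, div_self hS] at h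
  simp only [partitionFunction_eq_betheVector_one, h, coeffNZero, coeffN]
  have hc (i : Fin L) : theta p γ * theta p (τ + (L + 2) * γ) *
      theta p (τ + (L + 1) * γ + (x₀ - x i)) /
        (theta p (x₀ - x i) * theta p (τ + (L + 2) * γ) * theta p (τ + (L + 1) * γ)) =
      theta p γ * theta p (τ + (L + 1) * γ + x₀ - x i) /
        (theta p (x₀ - x i) * theta p (τ + (L + 1) * γ)) := by
    rw [← add_sub_assoc, mul_right_comm (theta p γ), mul_right_comm (theta p (x₀ - x i)),
      mul_div_mul_right _ _ hS]
  simp only [hc]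
  ring

/-! ### Continuity in `τ` away from the denominators that occur. -/

theorem continuousAt_rMatrix {p : ℝ} (hp0 : 0 < p) (hp1 : p < 1) (γ x : ℂ) {τ : ℂ}
    {a b c d : Fin 2} (h : (c : ℕ) + d = 1 → theta p τ ≠ 0) :
    ContinuousAt (fun τ => rMatrix p γ x τ (a, b) (c, d)) τ := by
  have hθ := (differentiable_theta hp0 hp1).continuous
  have h0 : ContinuousAt (theta p) τ := hθ.continuousAt
  have hf (f : ℂ → ℂ) (hf : Continuous f) (hτ : theta p τ ≠ 0) :
      ContinuousAt (fun τ => f τ / theta p τ) τ := hf.continuousAt.div h0 hτ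
  revert a b c d
  simp only [Fin.forall_fin_two, rMatrix_entries, rMatrix_zeros]
  simp only [continuousAt_const, implies_true, true_and, and_true]
  refine ⟨⟨fun h => ?_, fun h => ?_⟩, fun h => ?_, fun h => ?_⟩ <;>
    exact hf _ (by fun_prop) (h rfl)

theorem downs_le {L : ℕ} (s : Fin L → Fin 2) : downs s ≤ L := by
  have h : downs s ≤ ∑ _k : Fin L, 1 := Finset.sum_le_sum fun k _ => by omega
  simpa using h

/-- In the sector with `N` down spins only the dynamical denominators `[τ - γ(m - 2D)]` with
`m` sites to the right, `D` of them down, and `N - 1 - D` down spins to the left occur. -/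
theorem continuousAt_monodromy {p : ℝ} (hp0 : 0 < p) (hp1 : p < 1) (γ x : ℂ) {τ : ℂ} {L : ℕ}
    (μ : Fin L → ℂ) {N : ℕ}
    (hN : ∀ m D : ℕ, m < L → D ≤ m → D + 1 ≤ N → N + m ≤ D + L →
      theta p (τ - γ * (m - 2 * D)) ≠ 0)
    {a b : Fin 2} {s t : Fin L → Fin 2} (ht : (b : ℕ) + downs t = N) :
    ContinuousAt (fun τ => monodromy p γ μ x τ (a, s) (b, t)) τ := by
  induction L generalizing a N with
  | zero => simp only [monodromy_zero]; exact continuousAt_const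
  | succ L ih =>
    rw [downs_succ] at ht
    simp only [monodromy_succ_apply]
    refine tendsto_finsetSum _ fun c _ => ?_
    by_cases hc : (c : ℕ) + downs (Fin.tail s) = b + downs (Fin.tail t)
    -- Removing the first site leaves `N - t 0` down spins. Its R-matrix has a denominator only if
    -- it carries exactly one down spin, which forces `N = D + 1` at `m = L`.
    · refine ContinuousAt.mul ?_ (ih (Fin.tail μ) (N := N - t 0) ?_ (by omega))
      · refine ContinuousAt.comp (f := fun τ => τ - γ * totalWeight (Fin.tail s))
          (continuousAt_rMatrix hp0 hp1 γ _ fun h1 => ?_) (by fun_prop)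
        have hle : downs (Fin.tail s) ≤ L := downs_le _
        rw [totalWeight_eq]
        exact hN L _ (by omega) hle (by omega) (by omega)
      · intro m D h1 h2 h3 h4
        exact hN m D (by omega) h2 (by omega) (by omega)
    · simp only [monodromy_eq_zero _ _ _ _ _ hc, mul_zero]
      exact continuousAt_const

theorem betheVector_eq_zero (p : ℝ) (γ : ℂ) {L : ℕ} (μ : Fin L → ℂ) (τ : ℂ) {n : ℕ}
    (x : Fin n → ℂ) {s : Fin L → Fin 2} (hs : downs s ≠ n) : betheVector p γ μ τ x s = 0 := by
  induction n generalizing τ s with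
  | zero =>
    rw [betheVector_zero, ketZero_eq, if_neg]
    rwa [← downs_eq_zero]
  | succ n ih =>
    rw [← Fin.cons_self_tail x, betheVector_cons, Matrix.mulVec, dotProduct]
    refine Finset.sum_eq_zero fun u _ => ?_
    by_cases hu : downs u = n
    · rw [opB_eq_zero, zero_mul]
      omega
    · rw [ih _ _ hu, mul_zero]

/-- The window for `k` has length `L` and moves up by one with each `B`. At `n = L` it is exactly `1
≤ k ≤ L`. -/
theorem continuousAt_betheVector {p : ℝ} (hp0 : 0 < p) (hp1 : p < 1) (γ : ℂ) {τ : ℂ} {L : ℕ}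
    (μ : Fin L → ℂ) {n : ℕ} (x : Fin n → ℂ)
    (h : ∀ k : ℤ, n + 1 - L ≤ k → k ≤ n → theta p (τ + k * γ) ≠ 0) (s : Fin L → Fin 2) :
    ContinuousAt (fun τ => betheVector p γ μ τ x s) τ := by
  induction n generalizing τ s with
  | zero => simp only [betheVector_zero]; exact continuousAt_const
  | succ n ih =>
    rw [← Fin.cons_self_tail x]
    simp only [betheVector_cons, Matrix.mulVec, dotProduct]
    refine tendsto_finsetSum _ fun u _ => ?_
    by_cases hu : downs u = n
    · refine ContinuousAt.comp (f := fun τ => τ + γ)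
        (g := fun τ => opB p γ μ (x 0) τ s u * betheVector p γ μ τ (Fin.tail x) u)
        (ContinuousAt.mul ?_ (ih _ ?_ _)) (by fun_prop)
      · refine continuousAt_monodromy hp0 hp1 γ (x 0) μ (N := 1 + n) ?_ (by simp [hu])
        intro m D h1 h2 h3 h4
        -- The bound `k ≤ n + 1` uses `D ≤ m` and `D ≤ n`; the lower bound uses `D ≥ 0` and `D - m ≥
        -- n + 1 - L`.
        have := h (1 - m + 2 * D) (by push_cast; omega) (by push_cast; omega)
        convert this using 2
        push_cast
        ring
      · intro k h1 h2
        have := h (k + 1) (by push_cast; omega) (by push_cast; omega)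
        convert this using 2
        push_cast
        ring
    · simp only [betheVector_eq_zero _ _ _ _ _ hu, mul_zero]
      exact continuousAt_const

theorem continuousAt_partitionFunction {p : ℝ} (hp0 : 0 < p) (hp1 : p < 1) (γ : ℂ) {τ : ℂ}
    {L : ℕ} (μ x : Fin L → ℂ) (h : ∀ k ∈ Finset.Icc 1 L, theta p (τ + (k : ℂ) * γ) ≠ 0) :
    ContinuousAt (fun τ => partitionFunction p γ μ τ x) τ := by
  simp only [partitionFunction_eq_betheVector_one]
  refine continuousAt_betheVector hp0 hp1 γ μ x (fun k h1 h2 => ?_) 1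
  lift k to ℕ using by omega
  exact h k (Finset.mem_Icc.2 ⟨by omega, by omega⟩)

theorem continuousAt_coeffN {p : ℝ} (hp0 : 0 < p) (hp1 : p < 1) (γ : ℂ) {τ : ℂ} {L : ℕ}
    (μ x : Fin L → ℂ) {x₀ : ℂ} (i : Fin L) (hx₀ : theta p (x₀ - x i) ≠ 0)
    (hτ : theta p (τ + ((L : ℂ) + 1) * γ) ≠ 0) :
    ContinuousAt (fun τ => coeffN p γ τ μ x x₀ i) τ := by
  have hθ := (differentiable_theta hp0 hp1).continuous
  have hn : ContinuousAt (fun τ => theta p γ * theta p (τ + ((L : ℂ) + 1) * γ + x₀ - x i)) τ :=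
    Continuous.continuousAt (by fun_prop)
  have hd : ContinuousAt
      (fun τ => theta p (x₀ - x i) * theta p (τ + ((L : ℂ) + 1) * γ)) τ :=
    Continuous.continuousAt (by fun_prop)
  exact ((hn.div hd (mul_ne_zero hx₀ hτ)).mul_const _).mul_const _

end EllipticSOS

end

theorem theorem2 (p : ℝ) (hp0 : 0 < p) (hp1 : p < 1) (L : ℕ) (hL : 1 ≤ L)
    (γ τ x₀ : ℂ) (μ x : Fin L → ℂ)
    (hτ : ∀ k ∈ Finset.Icc 1 (L + 1), EllipticSOS.theta p (τ + (k : ℂ) * γ) ≠ 0)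
    (hx₀ : ∀ i, EllipticSOS.theta p (x₀ - x i) ≠ 0)
    (hx : ∀ i j, i ≠ j → EllipticSOS.theta p (x i - x j) ≠ 0) :
    EllipticSOS.coeffM p γ μ x₀ * EllipticSOS.partitionFunction p γ μ (τ + γ) x +
      (EllipticSOS.coeffNZero p γ μ x x₀ * EllipticSOS.partitionFunction p γ μ τ x +
        ∑ i, EllipticSOS.coeffN p γ τ μ x x₀ i *
          EllipticSOS.partitionFunction p γ μ τ (Function.update x i x₀)) = 0 := by
  have hτ' : ∀ k ∈ Finset.Icc 1 L, EllipticSOS.theta p (τ + (k : ℂ) * γ) ≠ 0 := fun k hk =>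
    hτ k (Finset.Icc_subset_Icc_right (Nat.le_succ L) hk)
  have hZ (y : Fin L → ℂ) :=
    EllipticSOS.continuousAt_partitionFunction hp0 hp1 γ μ y hτ'
  have hZ' : ContinuousAt (fun τ => EllipticSOS.partitionFunction p γ μ (τ + γ) x) τ := by
    refine ContinuousAt.comp (f := fun τ => τ + γ)
      (g := fun τ => EllipticSOS.partitionFunction p γ μ τ x)
      (EllipticSOS.continuousAt_partitionFunction hp0 hp1 γ μ x fun k hk => ?_) (by fun_prop)
    -- The shift to `τ + γ` raises the window to `2 ≤ k ≤ L + 1`, which includes the extra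
    -- denominator of the coefficients `N_i`.
    have h := hτ (k + 1) (by simp only [Finset.mem_Icc] at hk ⊢; omega)
    convert h using 2
    push_cast
    ring
  have hcont : ContinuousAt (fun τ =>
      EllipticSOS.coeffM p γ μ x₀ * EllipticSOS.partitionFunction p γ μ (τ + γ) x +
      (EllipticSOS.coeffNZero p γ μ x x₀ * EllipticSOS.partitionFunction p γ μ τ x +
        ∑ i, EllipticSOS.coeffN p γ τ μ x x₀ i *
          EllipticSOS.partitionFunction p γ μ τ (Function.update x i x₀))) τ := by
    refine (continuousAt_const.mul hZ').add ((continuousAt_const.mul (hZ x)).add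
      (tendsto_finsetSum _ fun i _ => ContinuousAt.mul ?_ (hZ _)))
    refine EllipticSOS.continuousAt_coeffN hp0 hp1 γ μ x i (hx₀ i) ?_
    exact_mod_cast hτ (L + 1) (by simp)
  have hdense := EllipticSOS.dense_generic hp0 hp1 ⟨_, hτ 1 (by simp)⟩ γ
  have := mem_closure_iff_nhdsWithin_neBot.1 (hdense τ)
  -- Along generic parameters tending to `τ`, the left-hand side tends to its value at `τ` and is
  -- constantly zero.
  refine tendsto_nhds_unique (l := nhdsWithin τ {τ | EllipticSOS.Generic p γ τ})
    (hcont.tendsto.mono_left nhdsWithin_le_nhds)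
    (tendsto_const_nhds.congr' ?_)
  filter_upwards [self_mem_nhdsWithin] with σ hσ
  exact (EllipticSOS.functional_equation_of_generic hp0 hp1 hσ μ x x₀ hx₀ hx).symm
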